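/- For vectors $v_1,\dots,v_m\in\mathbb{R}^{n+1}$ let $Z(v_1,\dots,v_m)=[0,v_1]+\dots+[0,v_m]$ be the zonotope (Minkowski sum of segments) with zone vectors $v_1,\dots,v_m$. A $\Pi$-zonotope is a translate of a zonotope $Z(V)$, where, for some $n\ge 0$, $V$ is a subset of the set $\{e_i-e_j : 1\le i<j\le n+1\}\subset\mathbb{R}^{n+1}$ of zone vectors of the $n$-dimensional permutahedron ($e_1,\dots,e_{n+1}$ being the standard basis); its dimension $d$ may be smaller than $n$. The combinatorial diameter of a $d$-dimensional polytope $P$ is the diameter of the edge graph of its dual polytope, that is, of the graph whose vertices are the facets of $P$ and in which two distinct facets are joined by an edge if and only if they share a face of $P$ of codimension $2$ (the empty set counts as a face of dimension $-1$, which matters only for $d\le 1$). Let $Z$ be a $d$-dimensional $\Pi$-zonotope, $d\ge 0$. Then the combinatorial diameter of $Z$ is at most $3$ if $d\le 6$, and at most $4$ if $d\ge 7$. -/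

import Mathlib

open scoped Pointwise

noncomputable section

/-- The zonotope `Z(V)`: the Minkowski sum of the segments `[0, v]`, `v ∈ V`. -/
def zonotope {E : Type*} [AddCommGroup E] [Module ℝ E] (V : Finset E) : Set E :=
  ∑ v ∈ V, segment ℝ 0 v

/-- The zone vectors `e_i - e_j`, `i < j`, of the `n`-dimensional permutahedron in `ℝ^(n+1)`. -/
def permutahedronZoneVectors (n : ℕ) : Set (EuclideanSpace ℝ (Fin (n + 1))) :=
  {v | ∃ i j : Fin (n + 1), i < j ∧
    v = EuclideanSpace.single i (1 : ℝ) - EuclideanSpace.single j (1 : ℝ)}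

/-- A `Π`-zonotope: (a translate of) a zonotope all of whose zone vectors are zone vectors of a
permutahedron. Its dimension may be smaller than `n`. -/
def IsPiZonotope {n : ℕ} (Z : Set (EuclideanSpace ℝ (Fin (n + 1)))) : Prop :=
  ∃ (V : Finset (EuclideanSpace ℝ (Fin (n + 1)))) (c : EuclideanSpace ℝ (Fin (n + 1))),
    (V : Set (EuclideanSpace ℝ (Fin (n + 1)))) ⊆ permutahedronZoneVectors n ∧
      Z = c +ᵥ zonotope V

section Polytope

variable {E : Type*} [NormedAddCommGroup E] [NormedSpace ℝ E]

open Classical in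
/-- The dimension of a convex set: the dimension of its affine hull, and `-1` for the empty set. -/
def polytopeDim (P : Set E) : ℤ :=
  if P.Nonempty then (Module.finrank ℝ (vectorSpan ℝ P) : ℤ) else -1

/-- `F` is a face of the polytope `P` of codimension `k`. Faces are the exposed subsets; the empty
set counts as a face, of dimension `-1`, as usual in the face lattice. -/
def IsFaceOfCodim (P : Set E) (k : ℕ) (F : Set E) : Prop :=
  IsExposed ℝ P F ∧ polytopeDim F = polytopeDim P - k

/-- The facets of `P`: its faces of codimension one. -/
def Facet (P : Set E) : Type _ := {F : Set E // IsFaceOfCodim P 1 F}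

/-- The edge graph of the dual polytope of `P`: its vertices are the facets of `P`, and two
different facets are adjacent when they share a face of `P` of codimension two. -/
def dualEdgeGraph (P : Set E) : SimpleGraph (Facet P) where
  Adj F H := F ≠ H ∧ ∃ G : Set E, IsFaceOfCodim P 2 G ∧ G ⊆ F.1 ∧ G ⊆ H.1
  symm := ⟨fun _ _ h => ⟨h.1.symm, h.2.imp fun _ hG => ⟨hG.1, hG.2.2, hG.2.1⟩⟩⟩
  loopless := ⟨fun _ h => h.1 rfl⟩

/-- The combinatorial diameter of `P` (it is `⊤` when the graph is not connected). -/
def combinatorialDiameter (P : Set E) : ℕ∞ := (dualEdgeGraph P).ediam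

end Polytope

end

/-! View the zone vectors as the edges of a graph on the coordinates. A face of the zonotope is
determined by the signs of a functional on the zone vectors, that is, by the signs of the jumps of a
vertex potential along the edges. The facets are exactly the faces in the direction of the indicator
of `A`, where `A` and `K \ A` are both connected and `K` is a component (`exists_indicatorFace_eq`,
`isFaceOfCodim_one_indicatorFace`); exchanging `A` and `K \ A` gives the opposite facet.

Bonds in different components give adjacent facets. Inside `K`, a partition into three connected
parts gives a belt of facets around the zonotope: a hexagon if every two parts are joined by an
edge, a quadrilateral otherwise. Given two bonds of one belt, a facet of the first is at distance at
most 2 from each facet of the second, and adjacent to one of the two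
(`SimpleGraph.SameBelt.facetDistLe`). Every belt step but the last may aim at whichever of two
opposite facets is adjacent, so `k ≥ 1` belt steps cost at most `k + 1` edges.

It remains to count belt steps. Nested sides need at most two (`BeltDistLeTwo.of_subset`). For
crossing sides `A`, `C`, cutting off a suitable component of `A ∩ C` or `A \ C` from `A` is one step
that leads to the nested case, so three steps always suffice and the distance is at most 4. If `K`
has at most 7 vertices, two steps suffice (`IsBondSide.beltDistLeTwo`), and the distance is at most
3. A component has at most `d + 1` vertices (`card_le_finrank_span_add_one`), so `d ≤ 6` is exactly
what this needs. -/

namespace SimpleGraph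

/-! ### Connected vertex sets and removable blocks -/

variable {α : Type*} {G : SimpleGraph α}

/-- A nonempty finite vertex set is cut-connected if it is the only nonempty subset of itself that
is closed under adjacency within it. -/
def CutConnected (G : SimpleGraph α) (S : Finset α) : Prop :=
  S.Nonempty ∧ ∀ T ⊆ S, T.Nonempty → (∀ a ∈ T, ∀ b ∈ S, G.Adj a b → b ∈ T) → T = S

/-- `X` is a connected component of the subgraph induced on `S`. -/
def IsComponentOf (G : SimpleGraph α) (S X : Finset α) : Prop :=
  X ⊆ S ∧ G.CutConnected X ∧ ∀ a ∈ X, ∀ b ∈ S, G.Adj a b → b ∈ X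

namespace CutConnected

theorem subset_of_closed [DecidableEq α] {S U : Finset α} (hS : G.CutConnected S)
    (hU : ∀ a ∈ U, ∀ b ∈ S, G.Adj a b → b ∈ U) {x : α} (hxS : x ∈ S) (hxU : x ∈ U) : S ⊆ U := by
  have := hS.2 (S ∩ U) Finset.inter_subset_left ⟨x, by simp [hxS, hxU]⟩ (by
    intro a ha b hb hab
    simp only [Finset.mem_inter] at ha ⊢
    exact ⟨hb, hU a ha.2 b hb hab⟩)
  exact Finset.inter_eq_left.1 this

theorem exists_adj {S T : Finset α} (hS : G.CutConnected S) (hTS : T ⊆ S) (hT : T.Nonempty)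
    (hne : T ≠ S) : ∃ a ∈ T, ∃ b ∈ S, b ∉ T ∧ G.Adj a b := by
  by_contra! h
  exact hne (hS.2 T hTS hT fun a ha b hb hab => by_contra fun hbT => h a ha b hb hbT hab)

theorem apply_eq {β : Type*} {S : Finset α} (hS : G.CutConnected S) {f : α → β}
    (hf : ∀ a ∈ S, ∀ b ∈ S, G.Adj a b → f a = f b) {a b : α} (ha : a ∈ S) (hb : b ∈ S) :
    f a = f b := by
  classical
  have := hS.2 (S.filter fun x => f a = f x) (Finset.filter_subset _ _) ⟨a, by simp [ha]⟩ (by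
    intro x hx y hy hxy
    simp only [Finset.mem_filter] at hx ⊢
    exact ⟨hy, hx.2.trans (hf x hx.1 y hy hxy)⟩)
  rw [← this] at hb
  exact (Finset.mem_filter.1 hb).2

theorem singleton (x : α) : G.CutConnected {x} :=
  ⟨⟨x, by simp⟩, fun _ hT hne _ => (Finset.subset_singleton_iff.1 hT).resolve_left hne.ne_empty⟩

theorem _root_.SimpleGraph.two_le_card_of_not_cutConnected {S : Finset α} (hS : S.Nonempty)
    (h : ¬ G.CutConnected S) : 2 ≤ S.card := by
  by_contra hlt
  obtain ⟨x, rfl⟩ := Finset.card_eq_one.1 (le_antisymm (by omega) hS.card_pos)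
  exact h (.singleton x)

variable [DecidableEq α]

theorem union_of_adj {S T : Finset α} (hS : G.CutConnected S) (hT : G.CutConnected T) {a b : α}
    (ha : a ∈ S) (hb : b ∈ T) (hab : a = b ∨ G.Adj a b) : G.CutConnected (S ∪ T) := by
  refine ⟨⟨a, by simp [ha]⟩, fun U hU hne hcl => hU.antisymm ?_⟩
  have hclS : ∀ x ∈ U, ∀ y ∈ S, G.Adj x y → y ∈ U := fun x hx y hy => hcl x hx y (by simp [hy])
  have hclT : ∀ x ∈ U, ∀ y ∈ T, G.Adj x y → y ∈ U := fun x hx y hy => hcl x hx y (by simp [hy])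
  obtain ⟨u, hu⟩ := hne
  rcases Finset.mem_union.1 (hU hu) with h | h
  · have h1 := hS.subset_of_closed hclS h hu
    have hbU : b ∈ U := by
      rcases hab with rfl | hab
      · exact h1 ha
      · exact hclT a (h1 ha) b hb hab
    exact Finset.union_subset h1 (hT.subset_of_closed hclT hb hbU)
  · have h1 := hT.subset_of_closed hclT h hu
    have haU : a ∈ U := by
      rcases hab with rfl | hab
      · exact h1 hb
      · exact hclS b (h1 hb) a ha hab.symm
    exact Finset.union_subset (hS.subset_of_closed hclS ha haU) h1

/-- Removing a component of the complement of a connected set keeps a set connected. -/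
theorem sdiff_of_isComponentOf_sdiff {S C X : Finset α} (hS : G.CutConnected S) (hCS : C ⊆ S)
    (hC : G.CutConnected C) (hX : G.IsComponentOf (S \ C) X) : G.CutConnected (S \ X) := by
  have hCX : C ⊆ S \ X := fun c hc => Finset.mem_sdiff.2
    ⟨hCS hc, fun hcX => (Finset.mem_sdiff.1 (hX.1 hcX)).2 hc⟩
  -- No edge joins `X` to the rest of `S \ C`, so a closed part of `S \ X` that avoids `C` is closed
  -- in `S` as well, hence empty. Thus everything left hangs on `C`.
  have key : ∀ T ⊆ S \ X, (∀ a ∈ T, ∀ b ∈ S \ X, G.Adj a b → b ∈ T) → Disjoint C T → T = ∅ := by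
    intro T hT hcl hd
    by_contra hne
    have := hS.2 T (hT.trans Finset.sdiff_subset) (Finset.nonempty_iff_ne_empty.2 hne) (by
      intro a ha b hb hab
      by_cases hbX : b ∈ X
      · have haX := hX.2.2 b hbX a (Finset.mem_sdiff.2 ⟨(Finset.mem_sdiff.1 (hT ha)).1,
          fun h => Finset.disjoint_left.1 hd h ha⟩) hab.symm
        exact absurd haX (Finset.mem_sdiff.1 (hT ha)).2
      · exact hcl a ha b (Finset.mem_sdiff.2 ⟨hb, hbX⟩) hab)
    obtain ⟨c, hc⟩ := hC.1
    exact Finset.disjoint_left.1 hd hc (this ▸ hCS hc)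
  refine ⟨hC.1.mono hCX, fun T hT hne hcl => ?_⟩
  by_cases hd : Disjoint C T
  · exact absurd (key T hT hcl hd) hne.ne_empty
  · obtain ⟨c, hcC, hcT⟩ := Finset.not_disjoint_iff.1 hd
    have hCT : C ⊆ T := hC.subset_of_closed (fun a ha b hb => hcl a ha b (hCX hb)) hcC hcT
    have h0 := key ((S \ X) \ T) Finset.sdiff_subset (by
      intro a ha b hb hab
      refine Finset.mem_sdiff.2 ⟨hb, fun hbT => ?_⟩
      exact (Finset.mem_sdiff.1 ha).2 (hcl b hbT a (Finset.mem_sdiff.1 ha).1 hab.symm))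
      (Finset.disjoint_left.2 fun c hc hc' => (Finset.mem_sdiff.1 hc').2 (hCT hc))
    exact hT.antisymm (Finset.sdiff_eq_empty_iff_subset.1 h0)

end CutConnected

variable [DecidableEq α]

namespace IsComponentOf

theorem subset_of_mem {S X T : Finset α} (hX : G.IsComponentOf S X) (hT : G.CutConnected T)
    (hTS : T ⊆ S) {x : α} (hxT : x ∈ T) (hxX : x ∈ X) : T ⊆ X :=
  hT.subset_of_closed (fun a ha b hb => hX.2.2 a ha b (hTS hb)) hxT hxX

theorem eq_or_disjoint {S X Y : Finset α} (hX : G.IsComponentOf S X) (hY : G.IsComponentOf S Y) :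
    X = Y ∨ Disjoint X Y := by
  refine or_iff_not_imp_right.2 fun h => ?_
  obtain ⟨x, hxX, hxY⟩ := Finset.not_disjoint_iff.1 h
  exact (hY.subset_of_mem hX.2.1 hX.1 hxX hxY).antisymm (hX.subset_of_mem hY.2.1 hY.1 hxY hxX)

end IsComponentOf

theorem exists_isComponentOf (G : SimpleGraph α) {S : Finset α} {x : α} (hx : x ∈ S) :
    ∃ X, G.IsComponentOf S X ∧ x ∈ X := by
  classical
  -- The component is the intersection of all closed subsets of `S` that contain `x`.
  let X : Finset α := S.filter fun y => ∀ T ⊆ S, (∀ a ∈ T, ∀ b ∈ S, G.Adj a b → b ∈ T) →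
    x ∈ T → y ∈ T
  have hXS : X ⊆ S := Finset.filter_subset _ _
  have hmem : ∀ {y}, y ∈ X ↔ y ∈ S ∧ ∀ T ⊆ S, (∀ a ∈ T, ∀ b ∈ S, G.Adj a b → b ∈ T) →
    x ∈ T → y ∈ T := Finset.mem_filter
  have hcl : ∀ a ∈ X, ∀ b ∈ S, G.Adj a b → b ∈ X := fun a ha b hb hab =>
    hmem.2 ⟨hb, fun T hT hTc hxT => hTc a ((hmem.1 ha).2 T hT hTc hxT) b hb hab⟩
  have hxX : x ∈ X := hmem.2 ⟨hx, fun _ _ _ h => h⟩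
  refine ⟨X, ⟨hXS, ⟨⟨x, hxX⟩, fun T hT hne hTc => hT.antisymm fun y hy => ?_⟩, hcl⟩, hxX⟩
  have hTS : ∀ a ∈ T, ∀ b ∈ S, G.Adj a b → b ∈ T := fun a ha b hb hab =>
    hTc a ha b (hcl a (hT ha) b hb hab) hab
  by_cases hxT : x ∈ T
  · exact (hmem.1 hy).2 T (hT.trans hXS) hTS hxT
  -- If `T` misses `x`, then `X \ T` is itself a closed set containing `x`, and minimality of `X`
  -- forces it to contain `t`.
  · obtain ⟨t, ht⟩ := hne
    have := (hmem.1 (hT ht)).2 (X \ T) (Finset.sdiff_subset.trans hXS) (by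
      intro a ha b hb hab
      have ha' := Finset.mem_sdiff.1 ha
      exact Finset.mem_sdiff.2 ⟨hcl a ha'.1 b hb hab,
        fun hbT => ha'.2 (hTS b hbT a (hXS ha'.1) hab.symm)⟩) (Finset.mem_sdiff.2 ⟨hxX, hxT⟩)
    exact absurd ht (Finset.mem_sdiff.1 this).2

/-- A partition of a connected set into at least two connected blocks has, besides any given block
`R`, a block whose removal leaves a connected set. -/
theorem CutConnected.exists_block_sdiff {S R : Finset α} (hS : G.CutConnected S)
    {P : Finset α → Prop} (hP : ∀ X, P X → X ⊆ S ∧ G.CutConnected X)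
    (hcover : ∀ x ∈ S, ∃ X, P X ∧ x ∈ X) (hdisj : ∀ X Y, P X → P Y → X = Y ∨ Disjoint X Y)
    (hR : P R) (hRS : R ≠ S) : ∃ X, P X ∧ X ≠ R ∧ G.CutConnected (S \ X) := by
  classical
  -- Pairs of a block `X` and a connected set `U` that contains `R` and avoids `X`. With `U` as
  -- large as possible it will be all of `S \ X`; in the quotient by the blocks, `X` plays the role
  -- of a leaf far from `R`.
  let Q : Finset (Finset α × Finset α) := (S.powerset ×ˢ S.powerset).filter fun p =>
    P p.1 ∧ p.1 ≠ R ∧ R ⊆ p.2 ∧ p.2 ⊆ S \ p.1 ∧ G.CutConnected p.2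
  have hQ : ∀ {X U}, (X, U) ∈ Q ↔ P X ∧ X ≠ R ∧ R ⊆ U ∧ U ⊆ S \ X ∧ G.CutConnected U := by
    intro X U
    simp only [Q, Finset.mem_filter, Finset.mem_product, Finset.mem_powerset]
    refine ⟨fun h => h.2, fun h => ⟨⟨(hP X h.1).1, h.2.2.2.1.trans Finset.sdiff_subset⟩, h⟩⟩
  have hRsub : ∀ X, P X → X ≠ R → R ⊆ S \ X := by
    intro X hX hne r hr
    refine Finset.mem_sdiff.2 ⟨(hP R hR).1 hr, fun hrX => ?_⟩
    exact Finset.disjoint_left.1 ((hdisj X R hX hR).resolve_left hne) hrX hr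
  have hne : Q.Nonempty := by
    obtain ⟨x, hx, hxR⟩ := Finset.exists_of_ssubset
      (Finset.ssubset_iff_subset_ne.2 ⟨(hP R hR).1, hRS⟩)
    obtain ⟨X, hX, hxX⟩ := hcover x hx
    have hXR : X ≠ R := fun h => hxR (h ▸ hxX)
    exact ⟨(X, R), hQ.2 ⟨hX, hXR, subset_rfl, hRsub X hX hXR, (hP R hR).2⟩⟩
  obtain ⟨⟨X, U⟩, hXU, hmax⟩ := Finset.exists_max_image Q (fun p => p.2.card) hne
  obtain ⟨hX, hXR, hRU, hUX, hU⟩ := hQ.1 hXU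
  refine ⟨X, hX, hXR, ?_⟩
  by_cases hUeq : U = S \ X
  · exact hUeq ▸ hU
  exfalso
  have hgrow : ∀ Y, P Y → Y ≠ R → ∀ U', U ⊆ U' → U' ⊆ S \ Y → G.CutConnected U' → U' = U := by
    intro Y hY hYR U' h1 h2 h3
    exact (Finset.eq_of_subset_of_card_le h1
      (hmax (Y, U') (hQ.2 ⟨hY, hYR, hRU.trans h1, h2, h3⟩))).symm
  have hcl : ∀ a ∈ U, ∀ b ∈ S \ X, G.Adj a b → b ∈ U := by
    intro a ha b hb hab
    by_contra hbU
    have h := hgrow X hX hXR (U ∪ {b}) Finset.subset_union_left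
      (Finset.union_subset hUX (Finset.singleton_subset_iff.2 hb))
      (hU.union_of_adj (.singleton b) ha (Finset.mem_singleton_self b) (Or.inr hab))
    exact hbU (h ▸ by simp)
  obtain ⟨y, hy, hyU⟩ := Finset.exists_of_ssubset (Finset.ssubset_iff_subset_ne.2 ⟨hUX, hUeq⟩)
  obtain ⟨hyS, hyX⟩ := Finset.mem_sdiff.1 hy
  obtain ⟨Y, hY, hyY⟩ := hcover y hyS
  have hYR : Y ≠ R := fun h => hyU (hRU (h ▸ hyY))
  have hXY : Disjoint X Y := (hdisj X Y hX hY).resolve_left fun h => hyX (h ▸ hyY)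
  have hUY : Disjoint U Y := by
    refine Finset.disjoint_left.2 fun u hu huY => hyU ?_
    refine (hP Y hY).2.subset_of_closed (fun a ha b hb => hcl a ha b ?_) huY hu hyY
    exact Finset.mem_sdiff.2 ⟨(hP Y hY).1 hb, fun h => Finset.disjoint_left.1 hXY h hb⟩
  have hUne : U ≠ S := fun h => hyU (h ▸ hyS)
  obtain ⟨a, ha, b, hb, hbU, hab⟩ := hS.exists_adj (hUX.trans Finset.sdiff_subset) hU.1 hUne
  have hbX : b ∈ X := by
    by_contra hbX
    exact hbU (hcl a ha b (Finset.mem_sdiff.2 ⟨hb, hbX⟩) hab)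
  -- By maximality `U` has no neighbours in `S \ X` outside itself, so it avoids some other block
  -- `Y`, and its only exit is into `X`. Then `U ∪ X` is connected, still avoids `Y`, and is larger.
  have h := hgrow Y hY hYR (U ∪ X) Finset.subset_union_left
    (Finset.union_subset
      (fun u hu => Finset.mem_sdiff.2 ⟨(Finset.mem_sdiff.1 (hUX hu)).1,
        Finset.disjoint_left.1 hUY hu⟩)
      (fun x hx => Finset.mem_sdiff.2 ⟨(hP X hX).1 hx, Finset.disjoint_left.1 hXY hx⟩))
    (hU.union_of_adj (hP X hX).2 ha hbX (Or.inr hab))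
  exact hbU (h ▸ Finset.mem_union_right _ hbX)

end SimpleGraph

/-! ### Bonds and steps in belts -/

namespace SimpleGraph

variable {α : Type*} [DecidableEq α] {G : SimpleGraph α}

/-- `A` is one side of a bond of the vertex set `K`: both `A` and `K \ A` are connected. -/
structure IsBondSide (G : SimpleGraph α) (K A : Finset α) : Prop where
  subset : A ⊆ K
  cutConnected : G.CutConnected A
  cutConnected_sdiff : G.CutConnected (K \ A)

/-- Three disjoint connected sets whose unions `X ∪ Y` and `Y ∪ Z` are connected. -/
structure IsBeltTriple (G : SimpleGraph α) (X Y Z : Finset α) : Prop where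
  disjoint_left : Disjoint X Y
  disjoint_right : Disjoint Y Z
  disjoint_outer : Disjoint X Z
  left : G.CutConnected X
  middle : G.CutConnected Y
  right : G.CutConnected Z
  union_left : G.CutConnected (X ∪ Y)
  union_right : G.CutConnected (Y ∪ Z)

/-- The bonds with sides `A` and `C` of `K` are different coarsenings of one partition of `K` into
three connected parts. -/
def SameBelt (G : SimpleGraph α) (K A C : Finset α) : Prop :=
  ∃ X Y Z, G.IsBeltTriple X Y Z ∧ X ∪ Y ∪ Z = K ∧ (A = X ∨ A = Y ∪ Z) ∧ (C = Z ∨ C = X ∪ Y)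

/-- The bonds with sides `A` and `C` coincide or can be joined by at most two steps in belts. -/
def BeltDistLeTwo (G : SimpleGraph α) (K A C : Finset α) : Prop :=
  A = C ∨ A = K \ C ∨ G.SameBelt K A C ∨ ∃ X, G.SameBelt K A X ∧ G.SameBelt K X C

theorem IsBeltTriple.symm {X Y Z : Finset α} (h : G.IsBeltTriple X Y Z) : G.IsBeltTriple Z Y X :=
  ⟨h.disjoint_right.symm, h.disjoint_left.symm, h.disjoint_outer.symm, h.right, h.middle, h.left,
    Finset.union_comm Y Z ▸ h.union_right, Finset.union_comm X Y ▸ h.union_left⟩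

theorem IsBondSide.compl {K A : Finset α} (h : G.IsBondSide K A) : G.IsBondSide K (K \ A) :=
  ⟨Finset.sdiff_subset, h.cutConnected_sdiff, by
    rw [Finset.sdiff_sdiff_eq_self h.subset]; exact h.cutConnected⟩

namespace SameBelt

variable {K A C : Finset α}

theorem symm (h : G.SameBelt K A C) : G.SameBelt K C A := by
  obtain ⟨X, Y, Z, ht, hK, hA, hC⟩ := h
  refine ⟨Z, Y, X, ht.symm, ?_, ?_, ?_⟩
  · rw [← hK, Finset.union_comm Z Y, Finset.union_comm, Finset.union_assoc]
  · rwa [Finset.union_comm Y X]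
  · rwa [Finset.union_comm Z Y]

theorem isBondSide_left (h : G.SameBelt K A C) : G.IsBondSide K A := by
  obtain ⟨X, Y, Z, ht, rfl, hA, -⟩ := h
  have h1 : (X ∪ Y ∪ Z) \ X = Y ∪ Z := by
    rw [Finset.union_assoc, Finset.union_sdiff_cancel_left
      (Finset.disjoint_union_right.2 ⟨ht.disjoint_left, ht.disjoint_outer⟩)]
  have hX : G.IsBondSide (X ∪ Y ∪ Z) X :=
    ⟨Finset.union_assoc X Y Z ▸ Finset.subset_union_left, ht.left, h1 ▸ ht.union_right⟩
  rcases hA with rfl | rfl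
  · exact hX
  · exact h1 ▸ hX.compl

theorem isBondSide_right (h : G.SameBelt K A C) : G.IsBondSide K C :=
  h.symm.isBondSide_left

theorem compl_left (h : G.SameBelt K A C) : G.SameBelt K (K \ A) C := by
  obtain ⟨X, Y, Z, ht, rfl, hA, hC⟩ := h
  refine ⟨X, Y, Z, ht, rfl, ?_, hC⟩
  have h1 : (X ∪ Y ∪ Z) \ X = Y ∪ Z := by
    rw [Finset.union_assoc, Finset.union_sdiff_cancel_left
      (Finset.disjoint_union_right.2 ⟨ht.disjoint_left, ht.disjoint_outer⟩)]
  rcases hA with rfl | rfl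
  · exact Or.inr h1
  · left
    rw [← h1, Finset.sdiff_sdiff_eq_self (Finset.union_assoc X Y Z ▸ Finset.subset_union_left)]

theorem compl_right (h : G.SameBelt K A C) : G.SameBelt K A (K \ C) :=
  h.symm.compl_left.symm

/-- The belt is the triple `K \ A`, `A \ X`, `X`, with the remainder `A \ X` in the middle. -/
theorem of_subset {X : Finset α} (hA : G.IsBondSide K A) (hXA : X ⊆ A) (hX : G.CutConnected X)
    (hAX : G.CutConnected (A \ X)) (hKX : G.CutConnected (K \ X)) : G.SameBelt K A X := by
  have h1 : K \ A ∪ A \ X = K \ X := by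
    ext x
    have := @hXA x
    have := @hA.subset x
    simp only [Finset.mem_union, Finset.mem_sdiff]
    tauto
  have h2 : A \ X ∪ X = A := Finset.sdiff_union_of_subset hXA
  refine ⟨K \ A, A \ X, X, ⟨?_, Finset.sdiff_disjoint, ?_, hA.cutConnected_sdiff, hAX, hX,
    h1 ▸ hKX, h2.symm ▸ hA.cutConnected⟩, ?_, Or.inr h2.symm, Or.inl rfl⟩
  · exact Finset.sdiff_disjoint.mono_right Finset.sdiff_subset
  · exact Finset.sdiff_disjoint.mono_right hXA
  · rw [h1, Finset.sdiff_union_of_subset (hXA.trans hA.subset)]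

end SameBelt

namespace BeltDistLeTwo

variable {K A C : Finset α}

theorem symm (hC : C ⊆ K) (h : G.BeltDistLeTwo K A C) : G.BeltDistLeTwo K C A := by
  rcases h with rfl | rfl | h | ⟨X, h1, h2⟩
  · exact Or.inl rfl
  · exact Or.inr (Or.inl (Finset.sdiff_sdiff_eq_self hC).symm)
  · exact Or.inr (Or.inr (Or.inl h.symm))
  · exact Or.inr (Or.inr (Or.inr ⟨X, h2.symm, h1.symm⟩))

/-- Belt steps concern bonds, not sides. This and its mirror image let later arguments replace a
side by its complement and so treat only one of four symmetric cases. -/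
theorem of_compl_right (hC : C ⊆ K) (h : G.BeltDistLeTwo K A (K \ C)) :
    G.BeltDistLeTwo K A C := by
  have hCC : K \ (K \ C) = C := Finset.sdiff_sdiff_eq_self hC
  rcases h with h | h | h | ⟨X, h1, h2⟩
  · exact Or.inr (Or.inl h)
  · exact Or.inl (h.trans hCC)
  · exact Or.inr (Or.inr (Or.inl (hCC ▸ h.compl_right)))
  · exact Or.inr (Or.inr (Or.inr ⟨X, h1, hCC ▸ h2.compl_right⟩))

theorem of_compl_left (hA : A ⊆ K) (hC : C ⊆ K) (h : G.BeltDistLeTwo K (K \ A) C) :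
    G.BeltDistLeTwo K A C :=
  ((h.symm hC).of_compl_right hA).symm hA

/-- If `C \ A` is connected, then `A`, `C \ A`, `K \ C` form a belt. Otherwise let `X` be a
component of `C \ A`. Both `C \ X` and `(K \ A) \ X` are connected, and they overlap in another
component of `C \ A`, so their union `K \ X` is connected; the bond of `X` is then one step from
each of the given ones. -/
theorem of_subset (hA : G.IsBondSide K A) (hC : G.IsBondSide K C) (hAC : A ⊆ C) :
    G.BeltDistLeTwo K A C := by
  by_cases hne : A = C
  · exact Or.inl hne
  obtain ⟨y, hyC, hyA⟩ := Finset.exists_of_ssubset (Finset.ssubset_iff_subset_ne.2 ⟨hAC, hne⟩)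
  by_cases hM : G.CutConnected (C \ A)
  · exact Or.inr (Or.inr (Or.inl
      (SameBelt.of_subset hC hAC hA.cutConnected hM hA.cutConnected_sdiff).symm))
  obtain ⟨X, hX, -⟩ := exists_isComponentOf G (Finset.mem_sdiff.2 ⟨hyC, hyA⟩)
  have hXC : X ⊆ C := hX.1.trans Finset.sdiff_subset
  have h1 : G.CutConnected (C \ X) :=
    hC.cutConnected.sdiff_of_isComponentOf_sdiff hAC hA.cutConnected hX
  have h2 : G.CutConnected ((K \ A) \ X) := by
    refine hA.cutConnected_sdiff.sdiff_of_isComponentOf_sdiff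
      (Finset.sdiff_subset_sdiff subset_rfl hAC) hC.cutConnected_sdiff ?_
    convert hX using 1
    ext z
    have := @hC.subset z
    simp only [Finset.mem_sdiff]
    tauto
  obtain ⟨z, hz, hzX⟩ := Finset.exists_of_ssubset (Finset.ssubset_iff_subset_ne.2
    ⟨hX.1, fun h => hM (h ▸ hX.2.1)⟩)
  obtain ⟨hzC, hzA⟩ := Finset.mem_sdiff.1 hz
  have h3 : G.CutConnected (K \ X) := by
    have h := h1.union_of_adj h2 (a := z) (b := z) (by simp [hzC, hzX])
      (by simp [hzA, hzX, hC.subset hzC]) (Or.inl rfl)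
    convert h using 1
    ext w
    have := @hC.subset w
    have := @hAC w
    simp only [Finset.mem_sdiff, Finset.mem_union]
    tauto
  have hXA : X ⊆ K \ A := hX.1.trans (Finset.sdiff_subset_sdiff hC.subset subset_rfl)
  refine Or.inr (Or.inr (Or.inr ⟨X, ?_, (SameBelt.of_subset hC hXC hX.2.1 h1 h3).symm⟩))
  have h := (SameBelt.of_subset hA.compl hXA hX.2.1 h2 h3).compl_left
  rwa [Finset.sdiff_sdiff_eq_self hA.subset] at h

end BeltDistLeTwo

/-- Two bonds, with sides `A` and `C`, all four of whose sides meet. -/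
structure IsCrossing (G : SimpleGraph α) (K A C : Finset α) : Prop where
  left : G.IsBondSide K A
  right : G.IsBondSide K C
  inter : (A ∩ C).Nonempty
  left_sdiff : (A \ C).Nonempty
  right_sdiff : (C \ A).Nonempty
  outer : ((K \ A) \ C).Nonempty

namespace IsCrossing

variable {K A C : Finset α}

theorem symm (h : G.IsCrossing K A C) : G.IsCrossing K C A :=
  ⟨h.right, h.left, Finset.inter_comm A C ▸ h.inter, h.right_sdiff, h.left_sdiff, by
    rw [sdiff_right_comm]; exact h.outer⟩

theorem _root_.Finset.sdiff_sdiff_eq_inter_of_subset {K A : Finset α} (hA : A ⊆ K)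
    (C : Finset α) : A \ (K \ C) = A ∩ C := by
  ext x
  have := @hA x
  simp only [Finset.mem_sdiff, Finset.mem_inter]
  tauto

theorem _root_.Finset.inter_sdiff_eq_sdiff_of_subset {K A : Finset α} (hA : A ⊆ K)
    (C : Finset α) : A ∩ (K \ C) = A \ C := by
  ext x
  have := @hA x
  simp only [Finset.mem_sdiff, Finset.mem_inter]
  tauto

theorem compl_right (h : G.IsCrossing K A C) : G.IsCrossing K A (K \ C) := by
  refine ⟨h.left, h.right.compl, ?_, ?_, ?_, ?_⟩
  · rw [Finset.inter_sdiff_eq_sdiff_of_subset h.left.subset]; exact h.left_sdiff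
  · rw [Finset.sdiff_sdiff_eq_inter_of_subset h.left.subset]; exact h.inter
  · rw [sdiff_right_comm]; exact h.outer
  · rw [Finset.sdiff_sdiff_eq_inter_of_subset Finset.sdiff_subset, Finset.inter_comm,
      Finset.inter_sdiff_eq_sdiff_of_subset h.right.subset]
    exact h.right_sdiff

theorem compl_left (h : G.IsCrossing K A C) : G.IsCrossing K (K \ A) C :=
  h.symm.compl_right.symm

/-- `K \ X` is the union of the connected sets `A \ X`, `K \ C` and `K \ A`; the first two overlap
in `A \ C`, the last two in the outer region. Hence `X` need only be removable from `A`. -/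
theorem cutConnected_sdiff (h : G.IsCrossing K A C) {X : Finset α} (hX : X ⊆ A ∩ C)
    (hAX : G.CutConnected (A \ X)) : G.CutConnected (K \ X) := by
  obtain ⟨u, hu⟩ := h.left_sdiff
  obtain ⟨v, hv⟩ := h.outer
  simp only [Finset.mem_sdiff] at hu hv
  have huX : u ∉ X := fun hx => hu.2 (Finset.mem_inter.1 (hX hx)).2
  have h1 := (hAX.union_of_adj h.right.cutConnected_sdiff (a := u) (b := u)
    (by simp [hu.1, huX]) (by simp [hu.2, h.left.subset hu.1]) (Or.inl rfl)).union_of_adj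
    h.left.cutConnected_sdiff (a := v) (b := v) (by simp [hv]) (by simp [hv]) (Or.inl rfl)
  convert h1 using 1
  ext w
  have := @hX w
  have := @h.left.subset w
  simp only [Finset.mem_sdiff, Finset.mem_union, Finset.mem_inter] at *
  tauto

theorem sameBelt (h : G.IsCrossing K A C) {X : Finset α} (hX : X ⊆ A ∩ C)
    (hXc : G.CutConnected X) (hAX : G.CutConnected (A \ X)) : G.SameBelt K A X :=
  .of_subset h.left (hX.trans Finset.inter_subset_left) hXc hAX (h.cutConnected_sdiff hX hAX)

theorem beltDistLeTwo_of_cutConnected_sdiff (h : G.IsCrossing K A C) {X : Finset α}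
    (hX : X ⊆ A ∩ C) (hXc : G.CutConnected X) (hAX : G.CutConnected (A \ X))
    (hCX : G.CutConnected (C \ X)) : G.BeltDistLeTwo K A C :=
  Or.inr (Or.inr (Or.inr ⟨X, h.sameBelt hX hXc hAX,
    (h.symm.sameBelt (Finset.inter_comm A C ▸ hX) hXc hCX).symm⟩))

end IsCrossing

/-- If a connected set `S` is split into `S ∩ C` and `S \ C`, then one of the components of these
two parts, different from a given one, can be removed without disconnecting `S`. -/
theorem CutConnected.exists_component_sdiff {S C R : Finset α} (hS : G.CutConnected S)
    (h1 : (S ∩ C).Nonempty) (h2 : (S \ C).Nonempty)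
    (hR : G.IsComponentOf (S ∩ C) R ∨ G.IsComponentOf (S \ C) R) :
    ∃ X, (G.IsComponentOf (S ∩ C) X ∨ G.IsComponentOf (S \ C) X) ∧ X ≠ R ∧
      G.CutConnected (S \ X) := by
  have hd : Disjoint (S ∩ C) (S \ C) := (Finset.disjoint_sdiff_inter S C).symm
  refine hS.exists_block_sdiff
    (P := fun X => G.IsComponentOf (S ∩ C) X ∨ G.IsComponentOf (S \ C) X) ?_ ?_ ?_ hR ?_
  · rintro X (hX | hX)
    · exact ⟨hX.1.trans Finset.inter_subset_left, hX.2.1⟩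
    · exact ⟨hX.1.trans Finset.sdiff_subset, hX.2.1⟩
  · intro x hx
    by_cases hxC : x ∈ C
    · obtain ⟨X, hX, hxX⟩ := exists_isComponentOf G (Finset.mem_inter.2 ⟨hx, hxC⟩)
      exact ⟨X, Or.inl hX, hxX⟩
    · obtain ⟨X, hX, hxX⟩ := exists_isComponentOf G (Finset.mem_sdiff.2 ⟨hx, hxC⟩)
      exact ⟨X, Or.inr hX, hxX⟩
  · rintro X Y (hX | hX) (hY | hY)
    · exact hX.eq_or_disjoint hY
    · exact Or.inr (hd.mono hX.1 hY.1)
    · exact Or.inr (hd.symm.mono hX.1 hY.1)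
    · exact hX.eq_or_disjoint hY
  · rintro rfl
    obtain ⟨x, hx⟩ := h1
    obtain ⟨y, hy⟩ := h2
    rcases hR with hR | hR
    · exact (Finset.mem_sdiff.1 hy).2
        (Finset.mem_inter.1 (hR.1 (Finset.mem_sdiff.1 hy).1)).2
    · exact (Finset.mem_sdiff.1 (hR.1 (Finset.mem_inter.1 hx).1)).2 (Finset.mem_inter.1 hx).2

theorem CutConnected.exists_component_sdiff' {S C : Finset α} (hS : G.CutConnected S)
    (h1 : (S ∩ C).Nonempty) (h2 : (S \ C).Nonempty) :
    ∃ X, (G.IsComponentOf (S ∩ C) X ∨ G.IsComponentOf (S \ C) X) ∧ G.CutConnected (S \ X) := by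
  obtain ⟨x, hx⟩ := h1
  obtain ⟨R, hR, -⟩ := exists_isComponentOf G hx
  obtain ⟨X, hX, -, h⟩ := hS.exists_component_sdiff ⟨x, hx⟩ h2 (Or.inl hR)
  exact ⟨X, hX, h⟩

/-- If one of the four regions is empty, a side of one bond lies inside a side of the other, and the
nested case applies. -/
theorem beltDistLeTwo_or_isCrossing {K A C : Finset α} (hA : G.IsBondSide K A)
    (hC : G.IsBondSide K C) : G.BeltDistLeTwo K A C ∨ G.IsCrossing K A C := by
  by_cases h1 : (A ∩ C).Nonempty
  · by_cases h2 : (A \ C).Nonempty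
    · by_cases h3 : (C \ A).Nonempty
      · by_cases h4 : ((K \ A) \ C).Nonempty
        · exact Or.inr ⟨hA, hC, h1, h2, h3, h4⟩
        · rw [Finset.not_nonempty_iff_eq_empty, Finset.sdiff_eq_empty_iff_subset] at h4
          exact Or.inl ((BeltDistLeTwo.of_subset hA.compl hC h4).of_compl_left hA.subset hC.subset)
      · rw [Finset.not_nonempty_iff_eq_empty, Finset.sdiff_eq_empty_iff_subset] at h3
        exact Or.inl ((BeltDistLeTwo.of_subset hC hA h3).symm hA.subset)
    · rw [Finset.not_nonempty_iff_eq_empty, Finset.sdiff_eq_empty_iff_subset] at h2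
      exact Or.inl (BeltDistLeTwo.of_subset hA hC h2)
  · rw [Finset.not_nonempty_iff_eq_empty] at h1
    refine Or.inl ((BeltDistLeTwo.of_subset hA hC.compl fun x hx => ?_).of_compl_right hC.subset)
    refine Finset.mem_sdiff.2 ⟨hA.subset hx, fun hxC => ?_⟩
    exact Finset.notMem_empty x (h1 ▸ Finset.mem_inter.2 ⟨hx, hxC⟩)

/-- Any two bonds of `K` can be joined by at most three steps in belts. -/
theorem IsBondSide.exists_sameBelt_beltDistLeTwo {K A C : Finset α} (hA : G.IsBondSide K A)
    (hC : G.IsBondSide K C) :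
    G.BeltDistLeTwo K A C ∨ ∃ X, G.SameBelt K A X ∧ G.BeltDistLeTwo K X C := by
  refine (beltDistLeTwo_or_isCrossing hA hC).imp_right fun h => ?_
  -- The removable component lies inside `C` or inside `K \ C`, so after one belt step the bonds are
  -- nested.
  obtain ⟨X, hX | hX, hAX⟩ := hA.cutConnected.exists_component_sdiff' h.inter h.left_sdiff
  · have hb := h.sameBelt hX.1 hX.2.1 hAX
    exact ⟨X, hb, .of_subset hb.isBondSide_right hC (hX.1.trans Finset.inter_subset_right)⟩
  · have hX1 : X ⊆ A ∩ (K \ C) := by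
      rw [Finset.inter_sdiff_eq_sdiff_of_subset hA.subset]; exact hX.1
    have hb := h.compl_right.sameBelt hX1 hX.2.1 hAX
    exact ⟨X, hb, (BeltDistLeTwo.of_subset hb.isBondSide_right hC.compl
      (hX1.trans Finset.inter_subset_right)).of_compl_right hC.subset⟩

namespace IsCrossing

variable {K A C : Finset α}

theorem card_eq (h : G.IsCrossing K A C) :
    (A ∩ C).card + (A \ C).card + (C \ A).card + ((K \ A) \ C).card = K.card := by
  have h1 := Finset.card_inter_add_card_sdiff A C
  have h2 := Finset.card_inter_add_card_sdiff (K \ A) C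
  have h3 := Finset.card_sdiff_add_card_eq_card h.left.subset
  rw [Finset.inter_comm, Finset.inter_sdiff_eq_sdiff_of_subset h.right.subset] at h2
  omega

/-- Write `B = K \ A`, `D = K \ C`, and suppose two steps do not suffice. Since `A ∩ C` is
connected, every component of `A \ C` can be removed from `A`, so none can be removed from `D`;
likewise no component of `C \ A` can be removed from `B`. The removable blocks, at least one `t` for
`B` and two, `z` and `w`, for `D`, are therefore components of the outer region, and no block may
serve both. If `A \ C` were connected, `t` could be removed from `D` too; so it is disconnected, and
similarly `C \ A`. The regions now have at least 3, 2, 2 and 1 vertices, which exceeds 7. -/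
theorem beltDistLeTwo_of_cutConnected_inter (h : G.IsCrossing K A C)
    (hAC : G.CutConnected (A ∩ C)) (hK : K.card ≤ 7) : G.BeltDistLeTwo K A C := by
  by_contra hnot
  have hA := h.left.subset
  have hC := h.right.subset
  have eBC : (K \ A) ∩ C = C \ A := by
    rw [Finset.inter_comm, Finset.inter_sdiff_eq_sdiff_of_subset hC]
  have eDA : (K \ C) ∩ A = A \ C := by
    rw [Finset.inter_comm, Finset.inter_sdiff_eq_sdiff_of_subset hA]
  have eBD : (K \ C) \ A = (K \ A) \ C := sdiff_right_comm _ _ _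
  have eBD' : (K \ A) ∩ (K \ C) = (K \ A) \ C :=
    Finset.inter_sdiff_eq_sdiff_of_subset Finset.sdiff_subset C
  have hAD : ∀ X, G.IsComponentOf (A \ C) X → ¬ G.CutConnected ((K \ C) \ X) := by
    intro X hX hDX
    refine hnot (BeltDistLeTwo.of_compl_right hC ?_)
    refine h.compl_right.beltDistLeTwo_of_cutConnected_sdiff (X := X) ?_ hX.2.1 ?_ hDX
    · rw [Finset.inter_sdiff_eq_sdiff_of_subset hA]; exact hX.1
    · refine h.left.cutConnected.sdiff_of_isComponentOf_sdiff Finset.inter_subset_left hAC ?_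
      rwa [Finset.sdiff_inter_self_left]
  have hBC : ∀ X, G.IsComponentOf (C \ A) X → ¬ G.CutConnected ((K \ A) \ X) := by
    intro X hX hBX
    refine hnot (BeltDistLeTwo.of_compl_left hA hC ?_)
    refine h.compl_left.beltDistLeTwo_of_cutConnected_sdiff (X := X) ?_ hX.2.1 hBX ?_
    · rw [eBC]; exact hX.1
    · refine h.right.cutConnected.sdiff_of_isComponentOf_sdiff Finset.inter_subset_right hAC ?_
      rwa [Finset.sdiff_inter_self_right]
  have hBD : ∀ X, G.IsComponentOf ((K \ A) \ C) X → G.CutConnected ((K \ A) \ X) →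
      ¬ G.CutConnected ((K \ C) \ X) := by
    intro X hX hBX hDX
    refine hnot (BeltDistLeTwo.of_compl_left hA hC (BeltDistLeTwo.of_compl_right hC ?_))
    refine h.compl_left.compl_right.beltDistLeTwo_of_cutConnected_sdiff (X := X) ?_ hX.2.1 hBX hDX
    rw [eBD']; exact hX.1
  have hB1 : ((K \ A) ∩ C).Nonempty := eBC ▸ h.right_sdiff
  have hD1 : ((K \ C) ∩ A).Nonempty := eDA ▸ h.left_sdiff
  have hD2 : ((K \ C) \ A).Nonempty := eBD ▸ h.outer
  obtain ⟨t, ht, htB⟩ := h.left.cutConnected_sdiff.exists_component_sdiff' hB1 h.outer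
  replace ht := ht.resolve_left fun h' => hBC t (eBC ▸ h') htB
  obtain ⟨z, hz, hzD⟩ := h.right.cutConnected_sdiff.exists_component_sdiff' hD1 hD2
  obtain ⟨w, hw, hwz, hwD⟩ := h.right.cutConnected_sdiff.exists_component_sdiff hD1 hD2 hz
  replace hz := hz.resolve_left fun h' => hAD z (eDA ▸ h') hzD
  replace hw := hw.resolve_left fun h' => hAD w (eDA ▸ h') hwD
  rw [eBD] at hz hw
  have hAD' : ¬ G.CutConnected (A \ C) := by
    intro hc
    refine hBD t ht htB (h.right.cutConnected_sdiff.sdiff_of_isComponentOf_sdiff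
      (Finset.sdiff_subset_sdiff hA subset_rfl) hc ?_)
    rwa [← eDA, Finset.sdiff_inter_self_left, eBD]
  have hBC' : ¬ G.CutConnected (C \ A) := by
    intro hc
    refine hBD z hz (h.left.cutConnected_sdiff.sdiff_of_isComponentOf_sdiff
      (Finset.sdiff_subset_sdiff hC subset_rfl) hc ?_) hzD
    rwa [← eBC, Finset.sdiff_inter_self_left]
  have htz : Disjoint t z := (ht.eq_or_disjoint hz).resolve_left fun e => hBD t ht htB (e ▸ hzD)
  have htw : Disjoint t w := (ht.eq_or_disjoint hw).resolve_left fun e => hBD t ht htB (e ▸ hwD)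
  have hzw : Disjoint z w := (hz.eq_or_disjoint hw).resolve_left hwz.symm
  have hle := Finset.card_le_card (Finset.union_subset (Finset.union_subset ht.1 hz.1) hw.1)
  rw [Finset.card_union_of_disjoint (Finset.disjoint_union_left.2 ⟨htw, hzw⟩),
    Finset.card_union_of_disjoint htz] at hle
  have := ht.2.1.1.card_pos
  have := hz.2.1.1.card_pos
  have := hw.2.1.1.card_pos
  have := h.inter.card_pos
  have := two_le_card_of_not_cutConnected h.left_sdiff hAD'
  have := two_le_card_of_not_cutConnected h.right_sdiff hBC'
  have := h.card_eq
  omega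

end IsCrossing

/-- In a set of at most seven vertices, any two bonds can be joined by two steps in belts. -/
theorem IsBondSide.beltDistLeTwo {K A C : Finset α} (hA : G.IsBondSide K A)
    (hC : G.IsBondSide K C) (hK : K.card ≤ 7) : G.BeltDistLeTwo K A C := by
  refine (beltDistLeTwo_or_isCrossing hA hC).elim id fun h => ?_
  by_cases h1 : G.CutConnected (A ∩ C)
  · exact h.beltDistLeTwo_of_cutConnected_inter h1 hK
  by_cases h2 : G.CutConnected (A \ C)
  · refine BeltDistLeTwo.of_compl_right hC.subset
      (h.compl_right.beltDistLeTwo_of_cutConnected_inter ?_ hK)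
    rwa [Finset.inter_sdiff_eq_sdiff_of_subset hA.subset]
  by_cases h3 : G.CutConnected (C \ A)
  · refine BeltDistLeTwo.of_compl_left hA.subset hC.subset
      (h.compl_left.beltDistLeTwo_of_cutConnected_inter ?_ hK)
    rwa [Finset.inter_comm, Finset.inter_sdiff_eq_sdiff_of_subset hC.subset]
  by_cases h4 : G.CutConnected ((K \ A) \ C)
  · refine BeltDistLeTwo.of_compl_left hA.subset hC.subset (BeltDistLeTwo.of_compl_right hC.subset
      (h.compl_left.compl_right.beltDistLeTwo_of_cutConnected_inter ?_ hK))
    rwa [Finset.inter_sdiff_eq_sdiff_of_subset Finset.sdiff_subset]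
  have := two_le_card_of_not_cutConnected h.inter h1
  have := two_le_card_of_not_cutConnected h.left_sdiff h2
  have := two_le_card_of_not_cutConnected h.right_sdiff h3
  have := two_le_card_of_not_cutConnected h.outer h4
  have := h.card_eq
  -- Four disconnected regions would have at least two vertices each, hence 8 in total.
  omega

/-- A connected set with at least two vertices has, besides any given vertex, one whose removal
leaves a connected set. -/
theorem CutConnected.exists_sdiff_singleton {S : Finset α} (hS : G.CutConnected S)
    (hcard : 2 ≤ S.card) {r : α} (hr : r ∈ S) : ∃ x ∈ S, x ≠ r ∧ G.CutConnected (S \ {x}) := by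
  obtain ⟨X, ⟨x, hx, rfl⟩, hne, h⟩ := hS.exists_block_sdiff (R := {r})
    (P := fun X => ∃ x ∈ S, X = {x})
    (by rintro X ⟨x, hx, rfl⟩; exact ⟨Finset.singleton_subset_iff.2 hx, .singleton x⟩)
    (fun x hx => ⟨{x}, ⟨x, hx, rfl⟩, Finset.mem_singleton_self x⟩)
    (by
      rintro _ _ ⟨x, -, rfl⟩ ⟨y, -, rfl⟩
      by_cases h : x = y
      · exact Or.inl (h ▸ rfl)
      · exact Or.inr (Finset.disjoint_singleton.2 h))
    ⟨r, hr, rfl⟩ (by rintro rfl; simp at hcard)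
  exact ⟨x, hx, fun e => hne (e ▸ rfl), h⟩

theorem CutConnected.exists_isBondSide {K : Finset α} (hK : G.CutConnected K)
    (hcard : 2 ≤ K.card) : ∃ A, G.IsBondSide K A := by
  obtain ⟨r, hr⟩ := hK.1
  obtain ⟨x, hx, -, h⟩ := hK.exists_sdiff_singleton hcard hr
  exact ⟨{x}, Finset.singleton_subset_iff.2 hx, .singleton x, h⟩

/-- Keep a vertex `a` of `A` with a neighbour outside `A` and remove another vertex `x` that does
not disconnect `A`; the edge at `a` keeps `K \ {x}` connected. -/
theorem IsBondSide.exists_sameBelt_of_two_le_card {K A : Finset α} (hA : G.IsBondSide K A)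
    (hK : G.CutConnected K) (hcard : 2 ≤ A.card) : ∃ X, G.SameBelt K A X := by
  obtain ⟨y, hy⟩ := hA.cutConnected_sdiff.1
  obtain ⟨a, ha, b, hb, hbA, hab⟩ := hK.exists_adj hA.subset hA.cutConnected.1
    (fun e => (Finset.mem_sdiff.1 hy).2 (e ▸ (Finset.mem_sdiff.1 hy).1))
  obtain ⟨x, hx, hxa, h⟩ := hA.cutConnected.exists_sdiff_singleton hcard ha
  refine ⟨{x}, .of_subset hA (Finset.singleton_subset_iff.2 hx) (.singleton x) h ?_⟩
  have h1 := h.union_of_adj hA.cutConnected_sdiff (a := a) (b := b) (by simp [ha, hxa.symm])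
    (by simp [hb, hbA]) (Or.inr hab)
  convert h1 using 1
  ext w
  have := @hA.subset w
  by_cases hw : w = x
  · simp [hw, hx]
  · simp only [Finset.mem_sdiff, Finset.mem_union, Finset.mem_singleton]
    tauto

theorem IsBondSide.exists_sameBelt {K A : Finset α} (hA : G.IsBondSide K A)
    (hK : G.CutConnected K) (hcard : 3 ≤ K.card) : ∃ X, G.SameBelt K A X := by
  by_cases h : 2 ≤ A.card
  · exact hA.exists_sameBelt_of_two_le_card hK h
  · have := Finset.card_sdiff_add_card_eq_card hA.subset
    obtain ⟨X, hX⟩ := hA.compl.exists_sameBelt_of_two_le_card hK (by omega)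
    have h' := hX.compl_left
    rw [Finset.sdiff_sdiff_eq_self hA.subset] at h'
    exact ⟨X, h'⟩

end SimpleGraph

/-! ### Faces of a zonotope and their dimensions -/

section ZonotopeFaces

variable {E : Type*} [NormedAddCommGroup E] [NormedSpace ℝ E]

theorem mem_vadd_zonotope {V : Finset E} {c x : E} :
    x ∈ c +ᵥ zonotope V ↔
      ∃ t : E → ℝ, (∀ v ∈ V, t v ∈ Set.Icc (0 : ℝ) 1) ∧ x = c + ∑ v ∈ V, t v • v := by
  rw [Set.mem_vadd_set]
  simp only [zonotope, Set.mem_finsetSum, vadd_eq_add]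
  constructor
  · rintro ⟨_, ⟨g, hg, rfl⟩, rfl⟩
    have : ∀ v, ∃ t : ℝ, v ∈ V → t ∈ Set.Icc (0 : ℝ) 1 ∧ t • v = g v := by
      intro v
      by_cases hv : v ∈ V
      · have := hg hv
        rw [segment_eq_image'] at this
        obtain ⟨t, ht, h⟩ := this
        exact ⟨t, fun _ => ⟨ht, by simpa using h⟩⟩
      · exact ⟨0, fun h => absurd h hv⟩
    choose t ht using this
    exact ⟨t, fun v hv => (ht v hv).1, by rw [Finset.sum_congr rfl fun v hv => (ht v hv).2]⟩
  · rintro ⟨t, ht, rfl⟩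
    refine ⟨_, ⟨fun v => t v • v, fun {v} hv => ?_, rfl⟩, rfl⟩
    rw [segment_eq_image']
    exact ⟨t v, ht v hv, by simp⟩

/-- The face of a set in the direction of a functional. -/
def faceInDirection (P : Set E) (l : StrongDual ℝ E) : Set E := {x ∈ P | ∀ y ∈ P, l y ≤ l x}

theorem isExposed_faceInDirection (P : Set E) (l : StrongDual ℝ E) :
    IsExposed ℝ P (faceInDirection P l) := fun _ => ⟨l, rfl⟩

variable {V : Finset E} {c : E} {l m : StrongDual ℝ E}

/-- A linear functional is maximised on each segment separately: the sign of `l v` forces the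
coefficient of `v`, which stays free where `l v = 0`. -/
theorem mem_faceInDirection_vadd_zonotope {x : E} :
    x ∈ faceInDirection (c +ᵥ zonotope V) l ↔ ∃ t : E → ℝ, (∀ v ∈ V, t v ∈ Set.Icc (0 : ℝ) 1 ∧
      (0 < l v → t v = 1) ∧ (l v < 0 → t v = 0)) ∧ x = c + ∑ v ∈ V, t v • v := by
  constructor
  · rintro ⟨hx, hmax⟩
    obtain ⟨t, ht, rfl⟩ := mem_vadd_zonotope.1 hx
    have hle := hmax (c + ∑ v ∈ V, (if 0 < l v then (1 : ℝ) else 0) • v)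
      (mem_vadd_zonotope.2 ⟨fun v => if 0 < l v then 1 else 0, fun v _ => by
        dsimp only; split_ifs <;> simp, rfl⟩)
    have hterm : ∀ v ∈ V, 0 ≤ ((if 0 < l v then (1 : ℝ) else 0) - t v) * l v := by
      intro v hv
      obtain ⟨h0, h1⟩ := ht v hv
      split_ifs with h
      · exact mul_nonneg (by linarith) h.le
      · nlinarith
    have hsum : ∑ v ∈ V, ((if 0 < l v then (1 : ℝ) else 0) - t v) * l v ≤ 0 := by
      simp only [map_add, map_sum, map_smul, smul_eq_mul, add_le_add_iff_left] at hle
      simp only [sub_mul, Finset.sum_sub_distrib]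
      linarith
    have hzero := (Finset.sum_eq_zero_iff_of_nonneg hterm).1
      (le_antisymm hsum (Finset.sum_nonneg hterm))
    refine ⟨t, fun v hv => ⟨ht v hv, fun h => ?_, fun h => ?_⟩, rfl⟩
    · have := hzero v hv
      rw [if_pos h] at this
      linarith [(mul_eq_zero.1 this).resolve_right h.ne']
    · have := hzero v hv
      rw [if_neg h.le.not_gt] at this
      linarith [(mul_eq_zero.1 this).resolve_right h.ne]
  · rintro ⟨t, ht, rfl⟩
    refine ⟨mem_vadd_zonotope.2 ⟨t, fun v hv => (ht v hv).1, rfl⟩, fun y hy => ?_⟩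
    obtain ⟨s, hs, rfl⟩ := mem_vadd_zonotope.1 hy
    simp only [map_add, map_sum, map_smul, smul_eq_mul, add_le_add_iff_left]
    refine Finset.sum_le_sum fun v hv => ?_
    obtain ⟨h0, h1⟩ := hs v hv
    rcases lt_trichotomy (l v) 0 with h | h | h
    · rw [(ht v hv).2.2 h]; nlinarith
    · simp [h]
    · rw [(ht v hv).2.1 h]; nlinarith

theorem faceInDirection_vadd_zonotope_subset
    (hpos : ∀ v ∈ V, 0 < l v → 0 < m v) (hneg : ∀ v ∈ V, l v < 0 → m v < 0) :
    faceInDirection (c +ᵥ zonotope V) m ⊆ faceInDirection (c +ᵥ zonotope V) l := by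
  intro x hx
  obtain ⟨t, ht, rfl⟩ := mem_faceInDirection_vadd_zonotope.1 hx
  exact mem_faceInDirection_vadd_zonotope.2 ⟨t, fun v hv => ⟨(ht v hv).1,
    fun h => (ht v hv).2.1 (hpos v hv h), fun h => (ht v hv).2.2 (hneg v hv h)⟩, rfl⟩

theorem faceInDirection_vadd_zonotope_nonempty :
    (faceInDirection (c +ᵥ zonotope V) l).Nonempty := by
  refine ⟨_, mem_faceInDirection_vadd_zonotope.2
    ⟨fun v => if 0 < l v then 1 else 0, fun v _ => ⟨?_, ?_, ?_⟩, rfl⟩⟩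
  · dsimp only; split_ifs <;> simp
  · intro h; simp [h]
  · intro h; simp [h.le.not_gt]

theorem vectorSpan_faceInDirection_vadd_zonotope :
    vectorSpan ℝ (faceInDirection (c +ᵥ zonotope V) l) =
      Submodule.span ℝ {v | v ∈ V ∧ l v = 0} := by
  apply le_antisymm
  · rw [vectorSpan_def, Submodule.span_le]
    rintro _ ⟨x, hx, y, hy, rfl⟩
    obtain ⟨t, ht, rfl⟩ := mem_faceInDirection_vadd_zonotope.1 hx
    obtain ⟨s, hs, rfl⟩ := mem_faceInDirection_vadd_zonotope.1 hy
    have : (c + ∑ v ∈ V, t v • v) -ᵥ (c + ∑ v ∈ V, s v • v) = ∑ v ∈ V, (t v - s v) • v := by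
      simp [sub_smul, Finset.sum_sub_distrib]
    simp only [this]
    refine Submodule.sum_mem _ fun v hv => ?_
    rcases lt_trichotomy (l v) 0 with h | h | h
    · simp [(ht v hv).2.2 h, (hs v hv).2.2 h]
    · exact Submodule.smul_mem _ _ (Submodule.subset_span ⟨hv, h⟩)
    · simp [(ht v hv).2.1 h, (hs v hv).2.1 h]
  · rw [Submodule.span_le]
    rintro v ⟨hv, hl⟩
    classical
    let t : E → ℝ := fun w => if 0 < l w then 1 else 0
    have ht : ∀ w, t w ∈ Set.Icc (0 : ℝ) 1 ∧ (0 < l w → t w = 1) ∧ (l w < 0 → t w = 0) := by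
      intro w
      refine ⟨?_, fun h => if_pos h, fun h => if_neg h.le.not_gt⟩
      simp only [t]; split_ifs <;> simp
    have hmem : ∀ s : E → ℝ, (∀ w ∈ V, s w ∈ Set.Icc (0 : ℝ) 1 ∧ (0 < l w → s w = 1) ∧
        (l w < 0 → s w = 0)) → c + ∑ w ∈ V, s w • w ∈ faceInDirection (c +ᵥ zonotope V) l :=
      fun s hs => mem_faceInDirection_vadd_zonotope.2 ⟨s, hs, rfl⟩
    -- Raising the free coefficient of `v` from 0 to 1 stays in the face, and the two points differ
    -- by `v`.
    have h := vsub_mem_vectorSpan ℝ (hmem (Function.update t v 1) fun w _ => ?_)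
      (hmem t fun w _ => ht w)
    · convert h using 1
      simp only [vsub_eq_sub, add_sub_add_left_eq_sub, ← Finset.sum_sub_distrib, ← sub_smul]
      rw [Finset.sum_eq_single_of_mem v hv]
      · simp [t, hl]
      · intro w _ hw
        simp [hw]
    · by_cases hw : w = v
      · subst hw; simp [hl]
      · simpa [hw] using ht w

theorem vectorSpan_vadd_zonotope :
    vectorSpan ℝ (c +ᵥ zonotope V) = Submodule.span ℝ (V : Set E) := by
  have h := vectorSpan_faceInDirection_vadd_zonotope (V := V) (c := c) (l := 0)
  have h0 : faceInDirection (c +ᵥ zonotope V) (0 : StrongDual ℝ E) = c +ᵥ zonotope V := by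
    ext x; simp [faceInDirection]
  rw [h0] at h
  simpa using h

theorem polytopeDim_vadd_zonotope :
    polytopeDim (c +ᵥ zonotope V) = Module.finrank ℝ (Submodule.span ℝ (V : Set E)) := by
  have h : (c +ᵥ zonotope V).Nonempty :=
    (faceInDirection_vadd_zonotope_nonempty (l := 0)).mono fun _ hx => hx.1
  rw [polytopeDim, if_pos h, vectorSpan_vadd_zonotope]

theorem polytopeDim_faceInDirection_vadd_zonotope :
    polytopeDim (faceInDirection (c +ᵥ zonotope V) l) =
      Module.finrank ℝ (Submodule.span ℝ {v | v ∈ V ∧ l v = 0}) := by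
  rw [polytopeDim, if_pos faceInDirection_vadd_zonotope_nonempty,
    vectorSpan_faceInDirection_vadd_zonotope]

end ZonotopeFaces

/-! ### Facets and ridges in terms of inner products -/

section Orthogonal

variable {E : Type*} [NormedAddCommGroup E] [InnerProductSpace ℝ E]

theorem mem_orthogonal_span_iff {S : Set E} {z : E} :
    z ∈ (Submodule.span ℝ S)ᗮ ↔ ∀ v ∈ S, inner ℝ z v = 0 := by
  rw [Submodule.mem_orthogonal']
  refine ⟨fun h v hv => h v (Submodule.subset_span hv), fun h u hu => ?_⟩
  have : Submodule.span ℝ S ≤ (innerSL ℝ z).ker :=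
    Submodule.span_le.2 fun v hv => by simpa using h v hv
  simpa using this hu

variable [FiniteDimensional ℝ E] {V : Finset E} {c x y : E}

theorem finrank_span_eq_sub_iff {S T : Set E} {k : ℕ} :
    (Module.finrank ℝ (Submodule.span ℝ S) : ℤ) = Module.finrank ℝ (Submodule.span ℝ T) - k ↔
      Module.finrank ℝ (Submodule.span ℝ S)ᗮ = Module.finrank ℝ (Submodule.span ℝ T)ᗮ + k := by
  have h1 := (Submodule.span ℝ S).finrank_add_finrank_orthogonal
  have h2 := (Submodule.span ℝ T).finrank_add_finrank_orthogonal
  omega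

theorem isFaceOfCodim_faceInDirection_iff {k : ℕ} :
    IsFaceOfCodim (c +ᵥ zonotope V) k (faceInDirection (c +ᵥ zonotope V) (innerSL ℝ x)) ↔
      Module.finrank ℝ (Submodule.span ℝ {v | v ∈ V ∧ inner ℝ x v = 0})ᗮ =
        Module.finrank ℝ (Submodule.span ℝ (V : Set E))ᗮ + k := by
  rw [IsFaceOfCodim, polytopeDim_faceInDirection_vadd_zonotope, polytopeDim_vadd_zonotope,
    ← finrank_span_eq_sub_iff]
  simp only [innerSL_apply_apply]
  exact and_iff_right (isExposed_faceInDirection _ _)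

/-- Let `W` and `N` be the orthogonal complements of all zone vectors and of those parallel to the
face. A facet means that `N` is one dimension larger than `W`. As `x ∈ N`, this says that `x ∉ W`
and `N = W + ℝ x`. -/
theorem isFaceOfCodim_one_faceInDirection_iff :
    IsFaceOfCodim (c +ᵥ zonotope V) 1 (faceInDirection (c +ᵥ zonotope V) (innerSL ℝ x)) ↔
      (∃ v ∈ V, inner ℝ x v ≠ 0) ∧ ∀ z : E, (∀ v ∈ V, inner ℝ x v = 0 → inner ℝ z v = 0) →
        ∃ a : ℝ, ∀ v ∈ V, inner ℝ z v = a * inner ℝ x v := by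
  rw [isFaceOfCodim_faceInDirection_iff]
  set W := (Submodule.span ℝ (V : Set E))ᗮ with hW
  set N := (Submodule.span ℝ {v | v ∈ V ∧ inner ℝ x v = 0})ᗮ with hN
  have hWN : W ≤ N := Submodule.orthogonal_le (Submodule.span_mono fun v hv => hv.1)
  have hxN : x ∈ N := mem_orthogonal_span_iff.2 fun v hv => hv.2
  have hle : W ⊔ Submodule.span ℝ {x} ≤ N :=
    sup_le hWN ((Submodule.span_singleton_le_iff_mem _ _).2 hxN)
  have hmemW : ∀ z, z ∈ W ↔ ∀ v ∈ V, inner ℝ z v = 0 := fun z => mem_orthogonal_span_iff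
  have hmemN : ∀ z, z ∈ N ↔ ∀ v ∈ V, inner ℝ x v = 0 → inner ℝ z v = 0 := fun z =>
    mem_orthogonal_span_iff.trans ⟨fun h v hv hx => h v ⟨hv, hx⟩, fun h v hv => h v hv.1 hv.2⟩
  have hmemS : ∀ z, z ∈ W ⊔ Submodule.span ℝ {x} ↔
      ∃ a : ℝ, ∀ v ∈ V, inner ℝ z v = a * inner ℝ x v := by
    intro z
    rw [Submodule.mem_sup]
    constructor
    · rintro ⟨w, hw, u, hu, rfl⟩
      obtain ⟨a, rfl⟩ := Submodule.mem_span_singleton.1 hu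
      exact ⟨a, fun v hv => by rw [inner_add_left, (hmemW w).1 hw v hv, real_inner_smul_left,
        zero_add]⟩
    · rintro ⟨a, ha⟩
      refine ⟨z - a • x, (hmemW _).2 fun v hv => ?_, a • x,
        Submodule.mem_span_singleton.2 ⟨a, rfl⟩, by simp⟩
      rw [inner_sub_left, real_inner_smul_left, ha v hv, sub_self]
  have hxW : (∃ v ∈ V, inner ℝ x v ≠ 0) ↔ x ∉ W := by
    rw [hmemW]; push Not; rfl
  rw [hxW]
  constructor
  · intro h
    have hx : x ∉ W := by
      intro hx
      have : N ≤ W := Submodule.orthogonal_le (Submodule.span_mono fun v hv =>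
        ⟨hv, (hmemW x).1 hx v hv⟩)
      have := Submodule.finrank_mono this
      omega
    refine ⟨hx, fun z hz => (hmemS z).1 ?_⟩
    rw [Submodule.eq_of_le_of_finrank_eq hle (by rw [Submodule.finrank_sup_span_singleton hx, h])]
    exact (hmemN z).2 hz
  · rintro ⟨hx, h⟩
    have : N = W ⊔ Submodule.span ℝ {x} :=
      le_antisymm (fun z hz => (hmemS z).2 (h z ((hmemN z).1 hz))) hle
    rw [this, Submodule.finrank_sup_span_singleton hx]

/-- Facets in directions `x` and `y` that agree in sign on all zone vectors share a ridge if `x`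
and `y` span, modulo the functionals that vanish on all zone vectors, the functionals vanishing on
the zone vectors common to both facets. -/
theorem exists_isFaceOfCodim_two_of_inner (hxy : ∀ v ∈ V, 0 ≤ inner ℝ x v * inner ℝ y v)
    (hx : ∃ v ∈ V, inner ℝ x v ≠ 0 ∧ inner ℝ y v = 0)
    (hy : ∃ v ∈ V, inner ℝ x v = 0 ∧ inner ℝ y v ≠ 0)
    (hspan : ∀ z : E, (∀ v ∈ V, inner ℝ x v = 0 → inner ℝ y v = 0 → inner ℝ z v = 0) →
      ∃ a b : ℝ, ∀ v ∈ V, inner ℝ z v = a * inner ℝ x v + b * inner ℝ y v) :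
    ∃ F, IsFaceOfCodim (c +ᵥ zonotope V) 2 F ∧
      F ⊆ faceInDirection (c +ᵥ zonotope V) (innerSL ℝ x) ∧
      F ⊆ faceInDirection (c +ᵥ zonotope V) (innerSL ℝ y) := by
  have hpos : ∀ v ∈ V, (0 < inner ℝ x v → 0 ≤ inner ℝ y v) ∧ (inner ℝ x v < 0 → inner ℝ y v ≤ 0) ∧
      (0 < inner ℝ y v → 0 ≤ inner ℝ x v) ∧ (inner ℝ y v < 0 → inner ℝ x v ≤ 0) := by
    intro v hv
    have := hxy v hv
    refine ⟨fun h => ?_, fun h => ?_, fun h => ?_, fun h => ?_⟩ <;> by_contra! <;> nlinarith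
  -- Because the signs never conflict, `x + y` vanishes on a zone vector only if both `x` and `y`
  -- do, and otherwise carries their common sign.
  refine ⟨faceInDirection (c +ᵥ zonotope V) (innerSL ℝ (x + y)), ?_, ?_, ?_⟩
  · rw [isFaceOfCodim_faceInDirection_iff]
    set W := (Submodule.span ℝ (V : Set E))ᗮ with hW
    have hmemW : ∀ z, z ∈ W ↔ ∀ v ∈ V, inner ℝ z v = 0 := fun z => mem_orthogonal_span_iff
    have hxW : x ∉ W := by
      obtain ⟨v, hv, h, -⟩ := hx
      exact fun hxW => h ((hmemW x).1 hxW v hv)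
    have hyW : y ∉ W ⊔ Submodule.span ℝ {x} := by
      intro h
      obtain ⟨w, hw, u, hu, hwu⟩ := Submodule.mem_sup.1 h
      obtain ⟨a, rfl⟩ := Submodule.mem_span_singleton.1 hu
      obtain ⟨v, hv, h0, hne⟩ := hy
      apply hne
      rw [← hwu, inner_add_left, (hmemW w).1 hw v hv, real_inner_smul_left, h0, mul_zero, add_zero]
    have heq : (Submodule.span ℝ {v | v ∈ V ∧ inner ℝ (x + y) v = 0})ᗮ =
        W ⊔ Submodule.span ℝ {x} ⊔ Submodule.span ℝ {y} := by
      have hzero : ∀ v ∈ V, inner ℝ (x + y) v = 0 ↔ inner ℝ x v = 0 ∧ inner ℝ y v = 0 := by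
        intro v hv
        obtain ⟨h1, h2, h3, h4⟩ := hpos v hv
        rw [inner_add_left]
        refine ⟨fun h => ?_, fun h => by rw [h.1, h.2, add_zero]⟩
        rcases lt_trichotomy (inner ℝ x v) 0 with hx | hx | hx
        · linarith [h2 hx]
        · exact ⟨hx, by linarith⟩
        · linarith [h1 hx]
      apply le_antisymm
      · intro z hz
        rw [mem_orthogonal_span_iff] at hz
        obtain ⟨a, b, hab⟩ := hspan z fun v hv h1 h2 => hz v ⟨hv, (hzero v hv).2 ⟨h1, h2⟩⟩
        have : z = (z - a • x - b • y) + a • x + b • y := by abel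
        rw [this]
        refine Submodule.add_mem_sup (Submodule.add_mem_sup ((hmemW _).2 fun v hv => ?_) ?_) ?_
        · rw [inner_sub_left, inner_sub_left, real_inner_smul_left, real_inner_smul_left,
            hab v hv]
          ring
        · exact Submodule.mem_span_singleton.2 ⟨a, rfl⟩
        · exact Submodule.mem_span_singleton.2 ⟨b, rfl⟩
      · refine sup_le (sup_le (Submodule.orthogonal_le (Submodule.span_mono fun v hv => hv.1)) ?_) ?_
        · rw [Submodule.span_singleton_le_iff_mem, mem_orthogonal_span_iff]
          exact fun v hv => ((hzero v hv.1).1 hv.2).1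
        · rw [Submodule.span_singleton_le_iff_mem, mem_orthogonal_span_iff]
          exact fun v hv => ((hzero v hv.1).1 hv.2).2
    rw [heq, Submodule.finrank_sup_span_singleton hyW, Submodule.finrank_sup_span_singleton hxW]
  · refine faceInDirection_vadd_zonotope_subset (fun v hv h => ?_) fun v hv h => ?_
    · simp only [innerSL_apply_apply, inner_add_left] at h ⊢
      linarith [(hpos v hv).1 h]
    · simp only [innerSL_apply_apply, inner_add_left] at h ⊢
      linarith [(hpos v hv).2.1 h]
  · refine faceInDirection_vadd_zonotope_subset (fun v hv h => ?_) fun v hv h => ?_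
    · simp only [innerSL_apply_apply, inner_add_left] at h ⊢
      linarith [(hpos v hv).2.2.1 h]
    · simp only [innerSL_apply_apply, inner_add_left] at h ⊢
      linarith [(hpos v hv).2.2.2 h]

end Orthogonal

/-! ### Facets of a Π-zonotope as bonds of its zone graph -/

section PiZonotope

variable {n : ℕ} {V : Finset (EuclideanSpace ℝ (Fin (n + 1)))}
  {c x y : EuclideanSpace ℝ (Fin (n + 1))}

/-- The graph with an edge `ij` for every zone vector `± (e_i - e_j)` in `V`. -/
def zoneGraph (V : Finset (EuclideanSpace ℝ (Fin (n + 1)))) : SimpleGraph (Fin (n + 1)) :=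
  SimpleGraph.fromRel fun i j =>
    EuclideanSpace.single i (1 : ℝ) - EuclideanSpace.single j (1 : ℝ) ∈ V

theorem inner_single_sub_single (x : EuclideanSpace ℝ (Fin (n + 1))) (i j : Fin (n + 1)) :
    inner ℝ x (EuclideanSpace.single i (1 : ℝ) - EuclideanSpace.single j (1 : ℝ)) = x i - x j := by
  simp [inner_sub_right, EuclideanSpace.inner_single_right]

theorem mem_or_mem_of_zoneGraph_adj {i j : Fin (n + 1)} (h : (zoneGraph V).Adj i j) :
    EuclideanSpace.single i (1 : ℝ) - EuclideanSpace.single j (1 : ℝ) ∈ V ∨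
      EuclideanSpace.single j (1 : ℝ) - EuclideanSpace.single i (1 : ℝ) ∈ V :=
  ((SimpleGraph.fromRel_adj _ _ _).1 h).2

theorem exists_zoneGraph_adj_of_mem (hV : (V : Set _) ⊆ permutahedronZoneVectors n)
    {v : EuclideanSpace ℝ (Fin (n + 1))} (hv : v ∈ V) : ∃ i j, (zoneGraph V).Adj i j ∧
      v = EuclideanSpace.single i (1 : ℝ) - EuclideanSpace.single j (1 : ℝ) := by
  obtain ⟨i, j, hij, rfl⟩ := hV hv
  exact ⟨i, j, (SimpleGraph.fromRel_adj _ _ _).2 ⟨hij.ne, Or.inl hv⟩, rfl⟩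

/-- Functionals become vertex potentials whose value on a zone vector is the jump along its edge.
The conditions do not change when an edge is reversed, so the orientation of the zone vectors plays
no role. -/
theorem isFaceOfCodim_one_iff_zoneGraph (hV : (V : Set _) ⊆ permutahedronZoneVectors n) :
    IsFaceOfCodim (c +ᵥ zonotope V) 1 (faceInDirection (c +ᵥ zonotope V) (innerSL ℝ x)) ↔
      (∃ i j, (zoneGraph V).Adj i j ∧ x i ≠ x j) ∧
      ∀ z : Fin (n + 1) → ℝ, (∀ i j, (zoneGraph V).Adj i j → x i = x j → z i = z j) →
        ∃ a : ℝ, ∀ i j, (zoneGraph V).Adj i j → z i - z j = a * (x i - x j) := by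
  rw [isFaceOfCodim_one_faceInDirection_iff]
  refine and_congr ⟨?_, ?_⟩ ⟨?_, ?_⟩
  · rintro ⟨v, hv, h⟩
    obtain ⟨i, j, hij, rfl⟩ := exists_zoneGraph_adj_of_mem hV hv
    exact ⟨i, j, hij, by rwa [inner_single_sub_single, sub_ne_zero] at h⟩
  · rintro ⟨i, j, hij, h⟩
    rcases mem_or_mem_of_zoneGraph_adj hij with hv | hv
    · exact ⟨_, hv, by rwa [inner_single_sub_single, sub_ne_zero]⟩
    · exact ⟨_, hv, by rw [inner_single_sub_single, sub_ne_zero]; exact h.symm⟩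
  · intro h z hz
    obtain ⟨a, ha⟩ := h (WithLp.toLp 2 z) fun v hv hx => by
      obtain ⟨i, j, hij, rfl⟩ := exists_zoneGraph_adj_of_mem hV hv
      rw [inner_single_sub_single, sub_eq_zero] at hx ⊢
      exact hz i j hij hx
    refine ⟨a, fun i j hij => ?_⟩
    rcases mem_or_mem_of_zoneGraph_adj hij with hv | hv
    · simpa only [inner_single_sub_single] using ha _ hv
    · have := ha _ hv
      simp only [inner_single_sub_single] at this
      linarith
  · intro h z hz
    obtain ⟨a, ha⟩ := h z fun i j hij hx => by
      rcases mem_or_mem_of_zoneGraph_adj hij with hv | hv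
      · have := hz _ hv
        rw [inner_single_sub_single, inner_single_sub_single, sub_eq_zero, sub_eq_zero] at this
        exact this hx
      · have := hz _ hv
        rw [inner_single_sub_single, inner_single_sub_single, sub_eq_zero, sub_eq_zero] at this
        exact (this hx.symm).symm
    refine ⟨a, fun v hv => ?_⟩
    obtain ⟨i, j, hij, rfl⟩ := exists_zoneGraph_adj_of_mem hV hv
    rw [inner_single_sub_single, inner_single_sub_single]
    exact ha i j hij

theorem exists_isFaceOfCodim_two_of_zoneGraph (hV : (V : Set _) ⊆ permutahedronZoneVectors n)
    (hxy : ∀ i j, (zoneGraph V).Adj i j → 0 ≤ (x i - x j) * (y i - y j))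
    (hx : ∃ i j, (zoneGraph V).Adj i j ∧ x i ≠ x j ∧ y i = y j)
    (hy : ∃ i j, (zoneGraph V).Adj i j ∧ x i = x j ∧ y i ≠ y j)
    (hspan : ∀ z : Fin (n + 1) → ℝ,
      (∀ i j, (zoneGraph V).Adj i j → x i = x j → y i = y j → z i = z j) →
      ∃ a b : ℝ, ∀ i j, (zoneGraph V).Adj i j → z i - z j = a * (x i - x j) + b * (y i - y j)) :
    ∃ F, IsFaceOfCodim (c +ᵥ zonotope V) 2 F ∧
      F ⊆ faceInDirection (c +ᵥ zonotope V) (innerSL ℝ x) ∧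
      F ⊆ faceInDirection (c +ᵥ zonotope V) (innerSL ℝ y) := by
  refine exists_isFaceOfCodim_two_of_inner ?_ ?_ ?_ ?_
  · intro v hv
    obtain ⟨i, j, hij, rfl⟩ := exists_zoneGraph_adj_of_mem hV hv
    rw [inner_single_sub_single, inner_single_sub_single]
    exact hxy i j hij
  · obtain ⟨i, j, hij, h1, h2⟩ := hx
    rcases mem_or_mem_of_zoneGraph_adj hij with hv | hv
    · refine ⟨_, hv, ?_⟩
      rw [inner_single_sub_single, inner_single_sub_single]
      exact ⟨sub_ne_zero.2 h1, sub_eq_zero.2 h2⟩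
    · refine ⟨_, hv, ?_⟩
      rw [inner_single_sub_single, inner_single_sub_single]
      exact ⟨sub_ne_zero.2 h1.symm, sub_eq_zero.2 h2.symm⟩
  · obtain ⟨i, j, hij, h1, h2⟩ := hy
    rcases mem_or_mem_of_zoneGraph_adj hij with hv | hv
    · refine ⟨_, hv, ?_⟩
      rw [inner_single_sub_single, inner_single_sub_single]
      exact ⟨sub_eq_zero.2 h1, sub_ne_zero.2 h2⟩
    · refine ⟨_, hv, ?_⟩
      rw [inner_single_sub_single, inner_single_sub_single]
      exact ⟨sub_eq_zero.2 h1.symm, sub_ne_zero.2 h2.symm⟩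
  · intro z hz
    obtain ⟨a, b, hab⟩ := hspan z fun i j hij h1 h2 => by
      rcases mem_or_mem_of_zoneGraph_adj hij with hv | hv
      · have := hz _ hv
        simp only [inner_single_sub_single, sub_eq_zero] at this
        exact this h1 h2
      · have := hz _ hv
        simp only [inner_single_sub_single, sub_eq_zero] at this
        exact (this h1.symm h2.symm).symm
    refine ⟨a, b, fun v hv => ?_⟩
    obtain ⟨i, j, hij, rfl⟩ := exists_zoneGraph_adj_of_mem hV hv
    simp only [inner_single_sub_single]
    exact hab i j hij

theorem faceInDirection_eq_of_zoneGraph (hV : (V : Set _) ⊆ permutahedronZoneVectors n) {a : ℝ}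
    (ha : 0 < a) (h : ∀ i j, (zoneGraph V).Adj i j → y i - y j = a * (x i - x j)) :
    faceInDirection (c +ᵥ zonotope V) (innerSL ℝ x) =
      faceInDirection (c +ᵥ zonotope V) (innerSL ℝ y) := by
  have key : ∀ v ∈ V, inner ℝ y v = a * inner ℝ x v := by
    intro v hv
    obtain ⟨i, j, hij, rfl⟩ := exists_zoneGraph_adj_of_mem hV hv
    simp only [inner_single_sub_single]
    exact h i j hij
  apply Set.Subset.antisymm <;> refine faceInDirection_vadd_zonotope_subset ?_ ?_ <;>
    simp only [innerSL_apply_apply] <;> intro v hv <;> rw [key v hv] <;> intro h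
  · exact pos_of_mul_pos_right h ha.le
  · exact neg_of_mul_neg_right h ha.le
  · exact mul_pos ha h
  · exact mul_neg_of_pos_of_neg ha h

/-- The indicator vector of a set of coordinates. -/
noncomputable def indicatorVector (A : Finset (Fin (n + 1))) : EuclideanSpace ℝ (Fin (n + 1)) :=
  WithLp.toLp 2 fun i => if i ∈ A then 1 else 0

theorem indicatorVector_of_mem {A : Finset (Fin (n + 1))} {i : Fin (n + 1)} (h : i ∈ A) :
    indicatorVector A i = 1 := if_pos h

theorem indicatorVector_of_notMem {A : Finset (Fin (n + 1))} {i : Fin (n + 1)} (h : i ∉ A) :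
    indicatorVector A i = 0 := if_neg h

/-- The face in the direction of the indicator vector of `A`. -/
def indicatorFace (V : Finset (EuclideanSpace ℝ (Fin (n + 1))))
    (c : EuclideanSpace ℝ (Fin (n + 1))) (A : Finset (Fin (n + 1))) :
    Set (EuclideanSpace ℝ (Fin (n + 1))) :=
  faceInDirection (c +ᵥ zonotope V) (innerSL ℝ (indicatorVector A))

variable {K L A B C X Y Z : Finset (Fin (n + 1))}

theorem SimpleGraph.IsComponentOf.mem_iff_of_adj {G : SimpleGraph (Fin (n + 1))}
    (hK : G.IsComponentOf Finset.univ K) {i j : Fin (n + 1)} (h : G.Adj i j) : i ∈ K ↔ j ∈ K :=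
  ⟨fun hi => hK.2.2 i hi j (Finset.mem_univ j) h,
    fun hj => hK.2.2 j hj i (Finset.mem_univ i) h.symm⟩

/-- A potential that is constant on both sides of a bond is an affine function of the indicator
vector of one side. -/
theorem SimpleGraph.IsBondSide.exists_eq_add_mul {G : SimpleGraph (Fin (n + 1))}
    (hA : G.IsBondSide K A) {z : Fin (n + 1) → ℝ}
    (hz : ∀ i ∈ K, ∀ j ∈ K, G.Adj i j → indicatorVector A i = indicatorVector A j → z i = z j) :
    ∃ r a : ℝ, ∀ i ∈ K, z i = r + a * indicatorVector A i := by
  obtain ⟨p, hp⟩ := hA.cutConnected.1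
  obtain ⟨q, hq⟩ := hA.cutConnected_sdiff.1
  refine ⟨z q, z p - z q, fun i hi => ?_⟩
  by_cases hiA : i ∈ A
  · rw [indicatorVector_of_mem hiA, hA.cutConnected.apply_eq (f := z) ?_ hiA hp]
    · ring
    · intro u hu v hv huv
      exact hz u (hA.subset hu) v (hA.subset hv) huv
        (by rw [indicatorVector_of_mem hu, indicatorVector_of_mem hv])
  · rw [indicatorVector_of_notMem hiA, hA.cutConnected_sdiff.apply_eq (f := z) ?_
      (Finset.mem_sdiff.2 ⟨hi, hiA⟩) hq]
    · ring
    · intro u hu v hv huv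
      rw [Finset.mem_sdiff] at hu hv
      exact hz u hu.1 v hv.1 huv
        (by rw [indicatorVector_of_notMem hu.2, indicatorVector_of_notMem hv.2])

theorem SimpleGraph.IsBondSide.exists_adj {G : SimpleGraph (Fin (n + 1))}
    (hA : G.IsBondSide K A) (hK : G.CutConnected K) : ∃ i ∈ A, ∃ j ∈ K, j ∉ A ∧ G.Adj i j := by
  refine hK.exists_adj hA.subset hA.cutConnected.1 ?_
  rintro rfl
  obtain ⟨q, hq⟩ := hA.cutConnected_sdiff.1
  simp at hq

theorem isFaceOfCodim_one_indicatorFace (hV : (V : Set _) ⊆ permutahedronZoneVectors n)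
    (hK : (zoneGraph V).IsComponentOf Finset.univ K) (hA : (zoneGraph V).IsBondSide K A) :
    IsFaceOfCodim (c +ᵥ zonotope V) 1 (indicatorFace V c A) := by
  refine (isFaceOfCodim_one_iff_zoneGraph hV).2 ⟨?_, fun z hz => ?_⟩
  · obtain ⟨i, hi, j, -, hj, hij⟩ := hA.exists_adj hK.2.1
    exact ⟨i, j, hij, by simp [indicatorVector_of_mem hi, indicatorVector_of_notMem hj]⟩
  · obtain ⟨r, a, h⟩ := hA.exists_eq_add_mul (z := z) fun i _ j _ => hz i j
    refine ⟨a, fun i j hij => ?_⟩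
    by_cases hi : i ∈ K
    · rw [h i hi, h j ((hK.mem_iff_of_adj hij).1 hi)]; ring
    · have hi' := fun h => hi (hA.subset h)
      have hj' := fun h => hi ((hK.mem_iff_of_adj hij).2 (hA.subset h))
      have e : indicatorVector A i = indicatorVector A j := by
        rw [indicatorVector_of_notMem hi', indicatorVector_of_notMem hj']
      rw [hz i j hij e, e]; ring

/-- Choose an edge `ij` along which the defining potential `x` jumps, and let `A` be the component
of `i` in its level set. The indicator of `A` is constant wherever `x` is constant along an edge, so
by the facet criterion its jumps are proportional to those of `x`. The nonemptiness assumption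
excludes the empty face, which need not come from a functional. -/
theorem exists_indicatorFace_eq (hV : (V : Set _) ⊆ permutahedronZoneVectors n)
    {F : Set (EuclideanSpace ℝ (Fin (n + 1)))} (hF : IsFaceOfCodim (c +ᵥ zonotope V) 1 F)
    (hne : F.Nonempty) : ∃ K A, (zoneGraph V).IsComponentOf Finset.univ K ∧
      (zoneGraph V).IsBondSide K A ∧ F = indicatorFace V c A := by
  obtain ⟨l, hl⟩ := hF.1 hne
  obtain ⟨x, rfl⟩ : ∃ x, innerSL ℝ x = l := (InnerProductSpace.toDual ℝ _).surjective l
  change F = faceInDirection (c +ᵥ zonotope V) (innerSL ℝ x) at hl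
  subst hl
  obtain ⟨⟨i, j, hij, hx⟩, hspan⟩ := (isFaceOfCodim_one_iff_zoneGraph hV).1 hF
  obtain ⟨K, hK, hiK⟩ := SimpleGraph.exists_isComponentOf (zoneGraph V) (Finset.mem_univ i)
  obtain ⟨A, hA, hiA⟩ := SimpleGraph.exists_isComponentOf (zoneGraph V)
    (S := Finset.univ.filter fun k => x k = x i) (by simp : i ∈ _)
  have hAx : ∀ {k}, k ∈ A → x k = x i := fun hk => (Finset.mem_filter.1 (hA.1 hk)).2
  have hmemA : ∀ u v, (zoneGraph V).Adj u v → x u = x v → (u ∈ A ↔ v ∈ A) := by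
    intro u v huv he
    refine ⟨fun h => hA.2.2 u h v ?_ huv, fun h => hA.2.2 v h u ?_ huv.symm⟩
    · simpa using he.symm.trans (hAx h)
    · simpa using he.trans (hAx h)
  have hAK : A ⊆ K := hK.subset_of_mem hA.2.1 (Finset.subset_univ _) hiA hiK
  have hjA : j ∉ A := fun h => hx (hAx h).symm
  obtain ⟨a, ha⟩ := hspan (indicatorVector A) fun u v huv he => by
    by_cases hu : u ∈ A
    · rw [indicatorVector_of_mem hu, indicatorVector_of_mem ((hmemA u v huv he).1 hu)]
    · rw [indicatorVector_of_notMem hu,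
        indicatorVector_of_notMem fun h => hu ((hmemA u v huv he).2 h)]
  have hane : a ≠ 0 := by
    rintro rfl
    have := ha i j hij
    rw [indicatorVector_of_mem hiA, indicatorVector_of_notMem hjA] at this
    norm_num at this
  have hbond : (zoneGraph V).IsBondSide K A := by
    refine ⟨hAK, hA.2.1, ⟨j, Finset.mem_sdiff.2 ⟨(hK.mem_iff_of_adj hij).1 hiK, hjA⟩⟩,
      fun T hT hTne hcl => ?_⟩
    obtain ⟨t, ht⟩ := hTne
    have hTA : ∀ {u}, u ∈ T → u ∈ K ∧ u ∉ A := fun hu => Finset.mem_sdiff.1 (hT hu)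
    have hmemT : ∀ u v, (zoneGraph V).Adj u v → x u = x v → u ∈ T → v ∈ T := by
      intro u v huv he hu
      refine hcl u hu v (Finset.mem_sdiff.2 ⟨(hK.mem_iff_of_adj huv).1 (hTA hu).1, fun h => ?_⟩) huv
      exact (hTA hu).2 ((hmemA u v huv he).2 h)
    obtain ⟨b, hb⟩ := hspan (indicatorVector T) fun u v huv he => by
      by_cases hu : u ∈ T
      · rw [indicatorVector_of_mem hu, indicatorVector_of_mem (hmemT u v huv he hu)]
      · rw [indicatorVector_of_notMem hu,
          indicatorVector_of_notMem fun h => hu (hmemT v u huv.symm he.symm h)]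
    -- A closed part `T` of `K \ A` has jumps proportional to those of `x` too. On `K` its indicator
    -- is therefore a multiple of that of `A` up to a constant, which fails if `T` is a proper
    -- nonempty part of `K \ A`.
    have hconst : ∀ {u v}, u ∈ K → v ∈ K →
        indicatorVector T u - b / a * indicatorVector A u =
          indicatorVector T v - b / a * indicatorVector A v := by
      refine fun {u v} hu hv => hK.2.1.apply_eq
        (f := fun w => indicatorVector T w - b / a * indicatorVector A w) ?_ hu hv
      intro u _ v _ huv
      have h1 := ha u v huv
      have h2 := hb u v huv
      have h3 : indicatorVector T u - indicatorVector T v =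
          b / a * (indicatorVector A u - indicatorVector A v) := by
        rw [h1, h2]; field_simp
      linarith
    refine hT.antisymm fun s hs => by_contra fun hsT => ?_
    obtain ⟨hsK, hsA⟩ := Finset.mem_sdiff.1 hs
    have := hconst (hTA ht).1 hsK
    rw [indicatorVector_of_mem ht, indicatorVector_of_notMem hsT, indicatorVector_of_notMem hsA,
      indicatorVector_of_notMem (hTA ht).2] at this
    norm_num at this
  rcases hane.lt_or_gt with hneg | hpos
  -- A negative factor means that `x` points to the opposite facet; the indicator of `K` has no
  -- jumps, so passing to `K \ A` reverses the sign.
  · refine ⟨K, K \ A, hK, hbond.compl, faceInDirection_eq_of_zoneGraph hV (neg_pos.2 hneg) ?_⟩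
    have hsum : ∀ u, indicatorVector (K \ A) u = indicatorVector K u - indicatorVector A u := by
      intro u
      by_cases huA : u ∈ A
      · simp [indicatorVector, huA, hAK huA]
      · simp [indicatorVector, huA]
    intro u v huv
    have h1 : indicatorVector K u = indicatorVector K v := by
      simp only [indicatorVector, hK.mem_iff_of_adj huv]
    have := ha u v huv
    rw [hsum, hsum, h1]
    linarith
  · exact ⟨K, A, hK, hbond, faceInDirection_eq_of_zoneGraph hV hpos ha⟩

/-- The dual edge graph distance of the faces in the directions of the indicator vectors of `A` and
`C`, as far as they are facets, is at most `k`. -/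
def FacetDistLe (V : Finset (EuclideanSpace ℝ (Fin (n + 1))))
    (c : EuclideanSpace ℝ (Fin (n + 1))) (A C : Finset (Fin (n + 1))) (k : ℕ∞) : Prop :=
  ∀ F H : Facet (c +ᵥ zonotope V), F.1 = indicatorFace V c A → H.1 = indicatorFace V c C →
    (dualEdgeGraph (c +ᵥ zonotope V)).edist F H ≤ k

theorem FacetDistLe.symm {k : ℕ∞} (h : FacetDistLe V c A C k) : FacetDistLe V c C A k :=
  fun F H hF hH => SimpleGraph.edist_comm (G := dualEdgeGraph (c +ᵥ zonotope V)) ▸ h H F hH hF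

theorem FacetDistLe.mono {k m : ℕ∞} (h : FacetDistLe V c A C k) (hkm : k ≤ m) :
    FacetDistLe V c A C m := fun F H hF hH => (h F H hF hH).trans hkm

/-- `FacetDistLe` is vacuous if an end is not a facet, so the intermediate face has to be known to
be one; this is why `B` must be a bond side. -/
theorem FacetDistLe.trans (hV : (V : Set _) ⊆ permutahedronZoneVectors n)
    (hK : (zoneGraph V).IsComponentOf Finset.univ K) (hB : (zoneGraph V).IsBondSide K B)
    {k m : ℕ∞} (h1 : FacetDistLe V c A B k) (h2 : FacetDistLe V c B C m) :
    FacetDistLe V c A C (k + m) := fun F H hF hH =>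
  (SimpleGraph.edist_triangle (v := ⟨_, isFaceOfCodim_one_indicatorFace hV hK hB⟩)).trans
    (add_le_add (h1 F _ hF rfl) (h2 _ H rfl hH))

theorem facetDistLe_one_of_exists
    (h : ∃ F, IsFaceOfCodim (c +ᵥ zonotope V) 2 F ∧ F ⊆ indicatorFace V c A ∧
      F ⊆ indicatorFace V c C) : FacetDistLe V c A C 1 := by
  intro F H hF hH
  rw [SimpleGraph.edist_le_one_iff_adj_or_eq]
  by_cases he : F = H
  · exact Or.inr he
  · obtain ⟨R, hR, h1, h2⟩ := h
    exact Or.inl ⟨he, R, hR, hF ▸ h1, hH ▸ h2⟩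

/-- No edge sees a jump of both indicators, so the signs cannot conflict and the two jumps can be
prescribed independently. -/
theorem facetDistLe_one_of_ne (hV : (V : Set _) ⊆ permutahedronZoneVectors n)
    (hK : (zoneGraph V).IsComponentOf Finset.univ K) (hA : (zoneGraph V).IsBondSide K A)
    (hL : (zoneGraph V).IsComponentOf Finset.univ L) (hC : (zoneGraph V).IsBondSide L C)
    (hKL : K ≠ L) : FacetDistLe V c A C 1 := by
  have hd : Disjoint K L := (hK.eq_or_disjoint hL).resolve_left hKL
  have hA0 : ∀ {i}, i ∉ K → indicatorVector A i = 0 := fun hi =>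
    indicatorVector_of_notMem fun h => hi (hA.subset h)
  have hC0 : ∀ {i}, i ∉ L → indicatorVector C i = 0 := fun hi =>
    indicatorVector_of_notMem fun h => hi (hC.subset h)
  have hKC : ∀ {i}, i ∈ K → indicatorVector C i = 0 := fun hi => hC0 (Finset.disjoint_left.1 hd hi)
  have hLA : ∀ {i}, i ∈ L → indicatorVector A i = 0 := fun hi =>
    hA0 (Finset.disjoint_right.1 hd hi)
  refine facetDistLe_one_of_exists (exists_isFaceOfCodim_two_of_zoneGraph hV ?_ ?_ ?_ ?_)
  · intro i j hij
    by_cases hi : i ∈ K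
    · rw [hKC hi, hKC ((hK.mem_iff_of_adj hij).1 hi)]; simp
    · rw [hA0 hi, hA0 fun h => hi ((hK.mem_iff_of_adj hij).2 h)]; simp
  · obtain ⟨i, hi, j, hjK, hj, hij⟩ := hA.exists_adj hK.2.1
    refine ⟨i, j, hij, ?_, by rw [hKC (hA.subset hi), hKC hjK]⟩
    simp [indicatorVector_of_mem hi, indicatorVector_of_notMem hj]
  · obtain ⟨i, hi, j, hjL, hj, hij⟩ := hC.exists_adj hL.2.1
    refine ⟨i, j, hij, by rw [hLA (hC.subset hi), hLA hjL], ?_⟩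
    simp [indicatorVector_of_mem hi, indicatorVector_of_notMem hj]
  · intro z hz
    obtain ⟨r, a, h1⟩ := hA.exists_eq_add_mul (z := z) fun i hi j hj hij he =>
      hz i j hij he (by rw [hKC hi, hKC hj])
    obtain ⟨s, b, h2⟩ := hC.exists_eq_add_mul (z := z) fun i hi j hj hij he =>
      hz i j hij (by rw [hLA hi, hLA hj]) he
    refine ⟨a, b, fun i j hij => ?_⟩
    by_cases hi : i ∈ K
    · have hj := (hK.mem_iff_of_adj hij).1 hi
      rw [h1 i hi, h1 j hj, hKC hi, hKC hj]; ring
    by_cases hi' : i ∈ L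
    · have hj := (hL.mem_iff_of_adj hij).1 hi'
      rw [h2 i hi', h2 j hj, hLA hi', hLA hj]; ring
    have hj : j ∉ K := fun h => hi ((hK.mem_iff_of_adj hij).2 h)
    have hj' : j ∉ L := fun h => hi' ((hL.mem_iff_of_adj hij).2 h)
    rw [hz i j hij (by rw [hA0 hi, hA0 hj]) (by rw [hC0 hi', hC0 hj']), hA0 hi, hA0 hj, hC0 hi',
      hC0 hj']
    ring

/-- Two potentials on a component that is split into three connected parts, the first of which
jumps only at `X` and the second only at `Z`, define faces that share a ridge, provided they do not
jump in opposite directions along an edge between `X` and `Z`. -/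
theorem SimpleGraph.IsBeltTriple.exists_isFaceOfCodim_two
    (hV : (V : Set _) ⊆ permutahedronZoneVectors n) (ht : (zoneGraph V).IsBeltTriple X Y Z)
    (hK : (zoneGraph V).IsComponentOf Finset.univ (X ∪ Y ∪ Z)) {p q r s : ℝ} (hpq : p ≠ q)
    (hrs : r ≠ s) (hxX : ∀ i ∈ X, x i = p) (hxY : ∀ i ∈ Y, x i = q) (hxZ : ∀ i ∈ Z, x i = q)
    (hx0 : ∀ i ∉ X ∪ Y ∪ Z, x i = 0) (hyX : ∀ i ∈ X, y i = r) (hyY : ∀ i ∈ Y, y i = r)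
    (hyZ : ∀ i ∈ Z, y i = s) (hy0 : ∀ i ∉ X ∪ Y ∪ Z, y i = 0)
    (hXZ : ∀ i ∈ X, ∀ j ∈ Z, (zoneGraph V).Adj i j → 0 ≤ (p - q) * (r - s)) :
    ∃ F, IsFaceOfCodim (c +ᵥ zonotope V) 2 F ∧
      F ⊆ faceInDirection (c +ᵥ zonotope V) (innerSL ℝ x) ∧
      F ⊆ faceInDirection (c +ᵥ zonotope V) (innerSL ℝ y) := by
  have hcases : ∀ i ∈ X ∪ Y ∪ Z, i ∈ X ∨ i ∈ Y ∨ i ∈ Z := by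
    intro i hi
    simpa only [Finset.mem_union, or_assoc] using hi
  have hsdiff : ∀ {S T : Finset (Fin (n + 1))} {i}, i ∈ S ∪ T → i ∉ S → i ∈ T := fun h h' =>
    (Finset.mem_union.1 h).resolve_left h'
  have hne : ∀ {S T : Finset (Fin (n + 1))}, Disjoint S T → T.Nonempty → S ≠ S ∪ T := by
    rintro S T hd ⟨t, ht⟩ he
    exact Finset.disjoint_right.1 hd ht (he ▸ Finset.mem_union_right S ht)
  refine exists_isFaceOfCodim_two_of_zoneGraph hV ?_ ?_ ?_ ?_
  · intro i j hij
    by_cases hi : i ∈ X ∪ Y ∪ Z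
    · rcases hcases i hi with h | h | h <;>
        rcases hcases j ((hK.mem_iff_of_adj hij).1 hi) with h' | h' | h'
      · simp [hxX i h, hxX j h']
      · simp [hyX i h, hyY j h']
      · rw [hxX i h, hxZ j h', hyX i h, hyZ j h']; exact hXZ i h j h' hij
      · simp [hyY i h, hyX j h']
      · simp [hxY i h, hxY j h']
      · simp [hxY i h, hxZ j h']
      · rw [hxZ i h, hxX j h', hyZ i h, hyX j h']
        linarith [hXZ j h' i h hij.symm]
      · simp [hxZ i h, hxY j h']
      · simp [hxZ i h, hxZ j h']
    · simp [hx0 i hi, hx0 j fun h => hi ((hK.mem_iff_of_adj hij).2 h)]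
  · obtain ⟨i, hi, j, hj, hjX, hij⟩ := ht.union_left.exists_adj Finset.subset_union_left ht.left.1
      (hne ht.disjoint_left ht.middle.1)
    have hjY := hsdiff hj hjX
    exact ⟨i, j, hij, by rwa [hxX i hi, hxY j hjY], by rw [hyX i hi, hyY j hjY]⟩
  · obtain ⟨i, hi, j, hj, hjY, hij⟩ := ht.union_right.exists_adj Finset.subset_union_left
      ht.middle.1 (hne ht.disjoint_right ht.right.1)
    have hjZ := hsdiff hj hjY
    exact ⟨i, j, hij, by rw [hxY i hi, hxZ j hjZ], by rwa [hyY i hi, hyZ j hjZ]⟩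
  · intro z hz
    obtain ⟨u, hu⟩ := ht.left.1
    obtain ⟨v, hv⟩ := ht.middle.1
    obtain ⟨w, hw⟩ := ht.right.1
    have hzX : ∀ i ∈ X, z i = z u := fun i hi => ht.left.apply_eq (f := z)
      (fun a ha b hb hab => hz a b hab (by rw [hxX a ha, hxX b hb]) (by rw [hyX a ha, hyX b hb]))
      hi hu
    have hzY : ∀ i ∈ Y, z i = z v := fun i hi => ht.middle.apply_eq (f := z)
      (fun a ha b hb hab => hz a b hab (by rw [hxY a ha, hxY b hb]) (by rw [hyY a ha, hyY b hb]))
      hi hv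
    have hzZ : ∀ i ∈ Z, z i = z w := fun i hi => ht.right.apply_eq (f := z)
      (fun a ha b hb hab => hz a b hab (by rw [hxZ a ha, hxZ b hb]) (by rw [hyZ a ha, hyZ b hb]))
      hi hw
    have hpq' := sub_ne_zero.2 hpq
    have hrs' := sub_ne_zero.2 hrs
    -- Only `x` jumps between `X` and `Y`, only `y` between `Y` and `Z`; the coefficients match the
    -- jumps of `z` there, normalised at the middle part.
    have hform : ∀ i ∈ X ∪ Y ∪ Z, z i = z v + (z u - z v) / (p - q) * (x i - q) +
        (z v - z w) / (r - s) * (y i - r) := by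
      intro i hi
      rcases hcases i hi with h | h | h
      · rw [hzX i h, hxX i h, hyX i h]; field_simp; ring
      · rw [hzY i h, hxY i h, hyY i h]; ring
      · rw [hzZ i h, hxZ i h, hyZ i h]; field_simp; ring
    refine ⟨(z u - z v) / (p - q), (z v - z w) / (r - s), fun i j hij => ?_⟩
    by_cases hi : i ∈ X ∪ Y ∪ Z
    · rw [hform i hi, hform j ((hK.mem_iff_of_adj hij).1 hi)]; ring
    · have hj := fun h => hi ((hK.mem_iff_of_adj hij).2 h)
      rw [hz i j hij (by rw [hx0 i hi, hx0 j hj]) (by rw [hy0 i hi, hy0 j hj]), hx0 i hi, hx0 j hj,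
        hy0 i hi, hy0 j hj]
      ring

end PiZonotope

/-! ### From belt steps to distances between facets -/

section PiZonotopeDiameter

variable {n : ℕ} {V : Finset (EuclideanSpace ℝ (Fin (n + 1)))}
  {c : EuclideanSpace ℝ (Fin (n + 1))} {K A C X Y Z : Finset (Fin (n + 1))}

namespace SimpleGraph.IsBeltTriple

/-- Both indicators decrease from `X` to `Z`, so edges between these parts do no harm. -/
theorem facetDistLe_left_union (hV : (V : Set _) ⊆ permutahedronZoneVectors n)
    (ht : (zoneGraph V).IsBeltTriple X Y Z)
    (hK : (zoneGraph V).IsComponentOf Finset.univ (X ∪ Y ∪ Z)) :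
    FacetDistLe V c X (X ∪ Y) 1 := by
  have h1 := @Finset.disjoint_left.1 ht.disjoint_left
  have h2 := @Finset.disjoint_left.1 ht.disjoint_right
  have h3 := @Finset.disjoint_left.1 ht.disjoint_outer
  refine facetDistLe_one_of_exists (ht.exists_isFaceOfCodim_two hV hK
    (x := indicatorVector (X)) (y := indicatorVector (X ∪ Y)) (p := 1) (q := 0) (r := 1)
    (s := 0) one_ne_zero one_ne_zero ?_ ?_ ?_ ?_ ?_ ?_ ?_ ?_ fun _ _ _ _ _ => by norm_num) <;>
  · intro i hi
    have := @h1 i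
    have := @h2 i
    have := @h3 i
    try simp only [Finset.mem_union] at hi
    simp [indicatorVector]
    try tauto

/-- Along an edge from `X` to `Z` the two indicators would jump in opposite directions. Without such
edges the belt is a quadrilateral and the facets are adjacent. -/
theorem facetDistLe_left_right (hV : (V : Set _) ⊆ permutahedronZoneVectors n)
    (ht : (zoneGraph V).IsBeltTriple X Y Z)
    (hK : (zoneGraph V).IsComponentOf Finset.univ (X ∪ Y ∪ Z))
    (hXZ : ∀ i ∈ X, ∀ j ∈ Z, ¬ (zoneGraph V).Adj i j) : FacetDistLe V c X Z 1 := by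
  have h1 := @Finset.disjoint_left.1 ht.disjoint_left
  have h2 := @Finset.disjoint_left.1 ht.disjoint_right
  have h3 := @Finset.disjoint_left.1 ht.disjoint_outer
  refine facetDistLe_one_of_exists (ht.exists_isFaceOfCodim_two hV hK
    (x := indicatorVector (X)) (y := indicatorVector (Z)) (p := 1) (q := 0) (r := 0)
    (s := 1) one_ne_zero zero_ne_one ?_ ?_ ?_ ?_ ?_ ?_ ?_ ?_
    fun i hi j hj hij => absurd hij (hXZ i hi j hj)) <;>
  · intro i hi
    have := @h1 i
    have := @h2 i
    have := @h3 i
    try simp only [Finset.mem_union] at hi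
    simp [indicatorVector]
    try tauto

theorem facetDistLe_union_union (hV : (V : Set _) ⊆ permutahedronZoneVectors n)
    (ht : (zoneGraph V).IsBeltTriple X Y Z)
    (hK : (zoneGraph V).IsComponentOf Finset.univ (X ∪ Y ∪ Z))
    (hXZ : ∀ i ∈ X, ∀ j ∈ Z, ¬ (zoneGraph V).Adj i j) :
    FacetDistLe V c (Y ∪ Z) (X ∪ Y) 1 := by
  have h1 := @Finset.disjoint_left.1 ht.disjoint_left
  have h2 := @Finset.disjoint_left.1 ht.disjoint_right
  have h3 := @Finset.disjoint_left.1 ht.disjoint_outer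
  refine facetDistLe_one_of_exists (ht.exists_isFaceOfCodim_two hV hK
    (x := indicatorVector (Y ∪ Z)) (y := indicatorVector (X ∪ Y)) (p := 0) (q := 1) (r := 1)
    (s := 0) zero_ne_one one_ne_zero ?_ ?_ ?_ ?_ ?_ ?_ ?_ ?_
    fun i hi j hj hij => absurd hij (hXZ i hi j hj)) <;>
  · intro i hi
    have := @h1 i
    have := @h2 i
    have := @h3 i
    try simp only [Finset.mem_union] at hi
    simp [indicatorVector]
    try tauto

/-- With an edge between `X` and `Z` every two parts are joined, so any of them may serve as the
middle one: the belt is a hexagon. -/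
theorem rotate {G : SimpleGraph (Fin (n + 1))} (ht : G.IsBeltTriple X Y Z) {i j : Fin (n + 1)}
    (hi : i ∈ X) (hj : j ∈ Z) (hij : G.Adj i j) : G.IsBeltTriple X Z Y :=
  ⟨ht.disjoint_outer, ht.disjoint_right.symm, ht.disjoint_left, ht.left, ht.right, ht.middle,
    ht.left.union_of_adj ht.right hi hj (Or.inr hij), Finset.union_comm Y Z ▸ ht.union_right⟩

end SimpleGraph.IsBeltTriple

theorem SimpleGraph.SameBelt.facetDistLe (hV : (V : Set _) ⊆ permutahedronZoneVectors n)
    (hK : (zoneGraph V).IsComponentOf Finset.univ K) (h : (zoneGraph V).SameBelt K A C) :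
    FacetDistLe V c A C 2 ∧ (FacetDistLe V c A C 1 ∨ FacetDistLe V c A (K \ C) 1) := by
  have key : ∀ {X Y Z}, (zoneGraph V).IsBeltTriple X Y Z → X ∪ Y ∪ Z = K →
      FacetDistLe V c X (X ∪ Y) 1 ∧ FacetDistLe V c (Y ∪ Z) Z 1 ∧
      (zoneGraph V).IsBondSide K (X ∪ Y) ∧ (zoneGraph V).IsBondSide K Z ∧ K \ (X ∪ Y) = Z := by
    rintro X Y Z ht rfl
    have hK' : (zoneGraph V).IsComponentOf Finset.univ (Z ∪ Y ∪ X) := by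
      rwa [Finset.union_comm Z Y, Finset.union_comm, ← Finset.union_assoc]
    have h1 : (X ∪ Y ∪ Z) \ (X ∪ Y) = Z := Finset.union_sdiff_cancel_left
      (Finset.disjoint_union_left.2 ⟨ht.disjoint_outer, ht.disjoint_right⟩)
    have h2 : (zoneGraph V).IsBondSide (X ∪ Y ∪ Z) (X ∪ Y) :=
      ⟨Finset.subset_union_left, ht.union_left, h1.symm ▸ ht.right⟩
    have hZ := h2.compl
    rw [h1] at hZ
    exact ⟨ht.facetDistLe_left_union hV hK,
      Finset.union_comm Y Z ▸ (ht.symm.facetDistLe_left_union hV hK').symm, h2,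
      hZ, h1⟩
  obtain ⟨X, Y, Z, ht, hXYZ, hA, hC⟩ := h
  obtain ⟨h1, h2, hb, hbZ, hc⟩ := key ht hXYZ
  have hc' : K \ Z = X ∪ Y := by rw [← hc, Finset.sdiff_sdiff_eq_self hb.subset]
  have h34 : FacetDistLe V c X Z 2 ∧ FacetDistLe V c (Y ∪ Z) (X ∪ Y) 2 := by
    by_cases hadj : ∀ i ∈ X, ∀ j ∈ Z, ¬ (zoneGraph V).Adj i j
    · exact ⟨(ht.facetDistLe_left_right hV (hXYZ ▸ hK) hadj).mono one_le_two,
        (ht.facetDistLe_union_union hV (hXYZ ▸ hK) hadj).mono one_le_two⟩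
    · push Not at hadj
      -- In the hexagon the paths are `X`, `X ∪ Z`, `Z` and `Y ∪ Z`, `Y`, `X ∪ Y`.
      obtain ⟨i, hi, j, hj, hij⟩ := hadj
      obtain ⟨k1, k2, kb, kbY, -⟩ := key (ht.rotate hi hj hij)
        (by rw [← hXYZ, Finset.union_right_comm])
      obtain ⟨m1, m2, -, -, -⟩ := key (ht.symm.rotate hj hi hij.symm)
        (by rw [← hXYZ, Finset.union_comm Z X, Finset.union_right_comm])
      rw [Finset.union_comm Z X] at m1
      rw [Finset.union_comm Z Y] at k2
      have := k1.trans hV hK kb m1.symm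
      have := k2.trans hV hK kbY m2.symm
      rw [one_add_one_eq_two] at *
      exact ⟨‹_›, ‹_›⟩
  rcases hA with rfl | rfl <;> rcases hC with rfl | rfl
  · exact ⟨h34.1, Or.inr (hc' ▸ h1)⟩
  · exact ⟨h1.mono one_le_two, Or.inl h1⟩
  · exact ⟨h2.mono one_le_two, Or.inl h2⟩
  · exact ⟨h34.2, Or.inr (hc.symm ▸ h2)⟩

/-- Every step in a belt but the last can be made along one edge, by passing to an opposite facet
if necessary. -/
theorem SimpleGraph.SameBelt.facetDistLe_one_add
    (hV : (V : Set _) ⊆ permutahedronZoneVectors n)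
    (hK : (zoneGraph V).IsComponentOf Finset.univ K) (h : (zoneGraph V).SameBelt K A X) {k : ℕ∞}
    (h1 : FacetDistLe V c X C k) (h2 : FacetDistLe V c (K \ X) C k) :
    FacetDistLe V c A C (1 + k) := by
  rcases (h.facetDistLe (c := c) hV hK).2 with h' | h'
  · exact h'.trans hV hK h.isBondSide_right h1
  · exact h'.trans hV hK h.isBondSide_right.compl h2

theorem SimpleGraph.SameBelt.facetDistLe_three (hV : (V : Set _) ⊆ permutahedronZoneVectors n)
    (hK : (zoneGraph V).IsComponentOf Finset.univ K) (h : (zoneGraph V).SameBelt K A X)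
    (h' : (zoneGraph V).SameBelt K X C) : FacetDistLe V c A C 3 := by
  have := h.facetDistLe_one_add hV hK (h'.facetDistLe (c := c) hV hK).1
    (h'.compl_left.facetDistLe hV hK).1
  rwa [show (1 + 2 : ℕ∞) = 3 by norm_num] at this

theorem facetDistLe_self : FacetDistLe V c A A 0 := by
  intro F H hF hH
  rw [Subtype.ext (hF.trans hH.symm)]
  simp

/-- A vector orthogonal to all zone vectors is constant on `K`, hence determined by its coordinates
outside `K.erase k`. So the orthogonal complement has codimension at least `K.card - 1`. -/
theorem card_le_finrank_span_add_one
    (hK : (zoneGraph V).IsComponentOf Finset.univ K) :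
    K.card ≤ Module.finrank ℝ (Submodule.span ℝ (V : Set (EuclideanSpace ℝ (Fin (n + 1))))) + 1 := by
  obtain ⟨k, hk⟩ := hK.2.1.1
  set W := (Submodule.span ℝ (V : Set (EuclideanSpace ℝ (Fin (n + 1)))))ᗮ with hW
  have hWadj : ∀ w ∈ W, ∀ i j, (zoneGraph V).Adj i j → w i = w j := by
    intro w hw i j hij
    rw [mem_orthogonal_span_iff] at hw
    rcases mem_or_mem_of_zoneGraph_adj hij with hv | hv
    · simpa only [inner_single_sub_single, sub_eq_zero] using hw _ hv
    · exact (by simpa only [inner_single_sub_single, sub_eq_zero] using hw _ hv : w j = w i).symm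
  let f : W →ₗ[ℝ] ({i // i ∈ (K.erase k)ᶜ} → ℝ) :=
    { toFun := fun w i => w.1 i.1
      map_add' := fun _ _ => rfl
      map_smul' := fun _ _ => rfl }
  have hf : Function.Injective f := by
    rw [injective_iff_map_eq_zero]
    rintro ⟨w, hw⟩ h
    have h0 : ∀ i, i ∉ K.erase k → w i = 0 := fun i hi =>
      congrFun h ⟨i, Finset.mem_compl.2 hi⟩
    ext i
    change w i = 0
    by_cases hi : i ∈ K
    · rw [hK.2.1.apply_eq (f := w) (fun a _ b _ hab => hWadj w hw a b hab) hi hk]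
      exact h0 k (Finset.notMem_erase k K)
    · exact h0 i fun h => hi (Finset.mem_of_mem_erase h)
  have h1 := LinearMap.finrank_le_finrank_of_injective hf
  have h2 := (Submodule.span ℝ
    (V : Set (EuclideanSpace ℝ (Fin (n + 1))))).finrank_add_finrank_orthogonal
  have h3 := Finset.card_erase_of_mem hk
  have h4 := Finset.card_le_univ (K.erase k)
  rw [Module.finrank_fintype_fun_eq_card, Fintype.card_coe, Finset.card_compl] at h1
  rw [finrank_euclideanSpace] at h2
  rw [← hW] at h2
  rw [Fintype.card_fin] at h1 h2 h4
  omega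

/-- If the zone vectors span more than a line, a component with at most two vertices is not the only
one with an edge. -/
theorem exists_isBondSide_of_card_le_two (hV : (V : Set _) ⊆ permutahedronZoneVectors n)
    (hK : (zoneGraph V).IsComponentOf Finset.univ K) (hA : (zoneGraph V).IsBondSide K A)
    (hcard : K.card ≤ 2) (hrank : 2 ≤ Module.finrank ℝ
      (Submodule.span ℝ (V : Set (EuclideanSpace ℝ (Fin (n + 1)))))) :
    ∃ L C, L ≠ K ∧ (zoneGraph V).IsComponentOf Finset.univ L ∧ (zoneGraph V).IsBondSide L C := by
  obtain ⟨p, hp, q, hq, hqA, hpq⟩ := hA.exists_adj hK.2.1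
  have hK2 : ∀ i ∈ K, i = p ∨ i = q := by
    have : ({p, q} : Finset _) = K := Finset.eq_of_subset_of_card_le
      (Finset.insert_subset (hA.subset hp) (Finset.singleton_subset_iff.2 hq))
      (by rwa [Finset.card_pair hpq.ne])
    intro i hi
    rw [← this] at hi
    simpa using hi
  by_cases h : ∃ i j, (zoneGraph V).Adj i j ∧ i ∉ K
  · obtain ⟨i, j, hij, hi⟩ := h
    obtain ⟨L, hL, hiL⟩ := SimpleGraph.exists_isComponentOf (zoneGraph V) (Finset.mem_univ i)
    have hjL := (hL.mem_iff_of_adj hij).1 hiL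
    obtain ⟨C, hC⟩ := hL.2.1.exists_isBondSide (Finset.one_lt_card.2 ⟨i, hiL, j, hjL, hij.ne⟩)
    exact ⟨L, C, fun e => hi (e ▸ hiL), hL, hC⟩
  · exfalso
    push Not at h
    have hle : Submodule.span ℝ (V : Set (EuclideanSpace ℝ (Fin (n + 1)))) ≤ Submodule.span ℝ
        {EuclideanSpace.single p (1 : ℝ) - EuclideanSpace.single q (1 : ℝ)} := by
      refine Submodule.span_le.2 fun v hv => ?_
      obtain ⟨i, j, hij, rfl⟩ := exists_zoneGraph_adj_of_mem hV hv
      have hmem := Submodule.mem_span_singleton_self (R := ℝ)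
        (EuclideanSpace.single p (1 : ℝ) - EuclideanSpace.single q (1 : ℝ))
      rcases hK2 i (h i j hij) with rfl | rfl <;> rcases hK2 j (h j i hij.symm) with rfl | rfl
      · exact absurd rfl hij.ne
      · exact hmem
      · exact neg_sub (EuclideanSpace.single j (1 : ℝ)) (EuclideanSpace.single i (1 : ℝ)) ▸
          neg_mem hmem
      · exact absurd rfl hij.ne
    have h1 := Submodule.finrank_mono hle
    have h2 := finrank_span_le_card (R := ℝ)
      ({EuclideanSpace.single p (1 : ℝ) - EuclideanSpace.single q (1 : ℝ)} :
        Set (EuclideanSpace ℝ (Fin (n + 1))))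
    simp at h2
    omega

/-- Opposite facets are joined through a belt that contains both. A component with two vertices has
no belt of its own, and the detour goes through a bond of another component, which exists because
the rank is at least 2. -/
theorem facetDistLe_compl (hV : (V : Set _) ⊆ permutahedronZoneVectors n)
    (hK : (zoneGraph V).IsComponentOf Finset.univ K) (hA : (zoneGraph V).IsBondSide K A)
    (hrank : 2 ≤ Module.finrank ℝ
      (Submodule.span ℝ (V : Set (EuclideanSpace ℝ (Fin (n + 1)))))) :
    FacetDistLe V c A (K \ A) 3 := by
  rcases le_or_gt K.card 2 with hcard | hcard
  · obtain ⟨L, C, hne, hL, hC⟩ := exists_isBondSide_of_card_le_two hV hK hA hcard hrank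
    have := (facetDistLe_one_of_ne (c := c) hV hK hA hL hC hne.symm).trans hV hL hC
      (facetDistLe_one_of_ne hV hL hC hK hA.compl hne)
    exact this.mono (by norm_num)
  · obtain ⟨X, hX⟩ := hA.exists_sameBelt hK.2.1 hcard
    exact hX.facetDistLe_three hV hK hX.symm.compl_right

theorem SimpleGraph.BeltDistLeTwo.facetDistLe (hV : (V : Set _) ⊆ permutahedronZoneVectors n)
    (hK : (zoneGraph V).IsComponentOf Finset.univ K) (hA : (zoneGraph V).IsBondSide K A)
    (hC : (zoneGraph V).IsBondSide K C) (hrank : 2 ≤ Module.finrank ℝ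
      (Submodule.span ℝ (V : Set (EuclideanSpace ℝ (Fin (n + 1))))))
    (h : (zoneGraph V).BeltDistLeTwo K A C) : FacetDistLe V c A C 3 := by
  rcases h with rfl | rfl | h | ⟨X, h1, h2⟩
  · exact facetDistLe_self.mono (by norm_num)
  · exact (facetDistLe_compl hV hK hC hrank).symm
  · exact (h.facetDistLe hV hK).1.mono (by norm_num)
  · exact h1.facetDistLe_three hV hK h2

theorem SimpleGraph.IsBondSide.facetDistLe_four (hV : (V : Set _) ⊆ permutahedronZoneVectors n)
    (hK : (zoneGraph V).IsComponentOf Finset.univ K) (hA : (zoneGraph V).IsBondSide K A)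
    (hC : (zoneGraph V).IsBondSide K C) (hrank : 2 ≤ Module.finrank ℝ
      (Submodule.span ℝ (V : Set (EuclideanSpace ℝ (Fin (n + 1)))))) :
    FacetDistLe V c A C 4 := by
  rcases hA.exists_sameBelt_beltDistLeTwo hC with h | ⟨X, hX, h⟩
  · exact (h.facetDistLe hV hK hA hC hrank).mono (by norm_num)
  · have hXb := hX.isBondSide_right
    have h' : (zoneGraph V).BeltDistLeTwo K (K \ X) C :=
      BeltDistLeTwo.of_compl_left Finset.sdiff_subset hC.subset
        (by rwa [Finset.sdiff_sdiff_eq_self hXb.subset])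
    have := hX.facetDistLe_one_add hV hK (h.facetDistLe (c := c) hV hK hXb hC hrank)
      (h'.facetDistLe hV hK hXb.compl hC hrank)
    rwa [show (1 + 3 : ℕ∞) = 4 by norm_num] at this

/-! ### Points and segments, where the empty face matters -/

section LowDimension

variable {E : Type*} [NormedAddCommGroup E] [NormedSpace ℝ E]

theorem eq_empty_of_polytopeDim_eq_neg_one {F : Set E} (h : polytopeDim F = -1) : F = ∅ := by
  by_contra hne
  rw [polytopeDim, if_pos (Set.nonempty_iff_ne_empty.2 hne)] at h
  omega

theorem combinatorialDiameter_eq_zero {P : Set E} (h : polytopeDim P = 0) :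
    combinatorialDiameter P = 0 := by
  have : Subsingleton (Facet P) := by
    have hempty : ∀ F : Facet P, F.1 = ∅ := fun F =>
      eq_empty_of_polytopeDim_eq_neg_one (by rw [F.2.2, h]; rfl)
    exact ⟨fun F H => Subtype.ext ((hempty F).trans (hempty H).symm)⟩
  exact SimpleGraph.ediam_eq_zero_of_subsingleton

theorem combinatorialDiameter_le_one {P : Set E} (h : polytopeDim P = 1) :
    combinatorialDiameter P ≤ 1 := by
  refine SimpleGraph.ediam_le_of_edist_le fun F H => ?_
  rw [SimpleGraph.edist_le_one_iff_adj_or_eq, or_iff_not_imp_right]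
  -- For a segment the empty set, of dimension -1, has codimension two and joins any two facets.
  refine fun hne => ⟨hne, ∅, ⟨fun h => absurd h Set.not_nonempty_empty, ?_⟩,
    Set.empty_subset _, Set.empty_subset _⟩
  rw [h, polytopeDim, if_neg Set.not_nonempty_empty]
  norm_num

theorem Facet.nonempty {P : Set E} (h : 2 ≤ polytopeDim P) (F : Facet P) : F.1.Nonempty := by
  by_contra hF
  have := F.2.2
  rw [polytopeDim, if_neg hF] at this
  omega

end LowDimension

end PiZonotopeDiameter

theorem mainTheorem4 (n d : ℕ) (Z : Set (EuclideanSpace ℝ (Fin (n + 1))))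
    (hZ : IsPiZonotope Z) (hd : polytopeDim Z = (d : ℤ)) :
    (d ≤ 6 → combinatorialDiameter Z ≤ 3) ∧ (7 ≤ d → combinatorialDiameter Z ≤ 4) := by
  obtain ⟨V, c, hV, rfl⟩ := hZ
  obtain rfl | rfl | hd2 : d = 0 ∨ d = 1 ∨ 2 ≤ d := by omega
  · exact ⟨fun _ => (combinatorialDiameter_eq_zero hd).trans_le zero_le, by omega⟩
  · exact ⟨fun _ => (combinatorialDiameter_le_one hd).trans (by norm_num), by omega⟩
  have hrank : Module.finrank ℝ
      (Submodule.span ℝ (V : Set (EuclideanSpace ℝ (Fin (n + 1))))) = d := by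
    rw [polytopeDim_vadd_zonotope] at hd
    exact_mod_cast hd
  have key : ∀ k : ℕ∞, 3 ≤ k → (d ≤ 6 ∨ 4 ≤ k) →
      combinatorialDiameter (c +ᵥ zonotope V) ≤ k := by
    intro k hk hdk
    refine SimpleGraph.ediam_le_of_edist_le fun F H => ?_
    obtain ⟨K, A, hK, hA, hF⟩ := exists_indicatorFace_eq hV F.2 (F.nonempty (by omega))
    obtain ⟨L, C, hL, hC, hH⟩ := exists_indicatorFace_eq hV H.2 (H.nonempty (by omega))
    by_cases hKL : K = L
    · subst hKL
      rcases hdk with hd6 | hk4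
      -- For `d ≤ 6` this gives at most 7 vertices in `K`, the bound under which two belt steps
      -- suffice.
      · have hcard := card_le_finrank_span_add_one hK
        exact ((hA.beltDistLeTwo hC (by omega)).facetDistLe hV hK hA hC (by omega) F H hF hH).trans
          hk
      · exact (hA.facetDistLe_four hV hK hC (by omega) F H hF hH).trans hk4
    · exact (facetDistLe_one_of_ne hV hK hA hL hC hKL F H hF hH).trans (le_trans (by norm_num) hk)
  exact ⟨fun h => key 3 le_rfl (Or.inl h), fun _ => key 4 (by norm_num) (Or.inr le_rfl)⟩
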